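/- Let $S^{n-1}$ be the Euclidean unit sphere of $\mathbb{R}^n$. A convex body is a compact convex set with non-empty interior; a set $K\subset\mathbb{R}^n$ is origin-symmetric if $-K=K$; and $\rho_K(x)=\max\{a>0: ax\in K\}$, $x\neq 0$, is the radial function of $K$. An origin-symmetric star body $K$ in $\mathbb{R}^n$ (in particular, an origin-symmetric convex body) is an intersection body if there is a finite non-negative Borel measure $\mu$ on $S^{n-1}$ whose spherical Radon transform is $\rho_K$, that is, $$\int_{S^{n-1}}\rho_K(x)f(x)\,dx=\int_{S^{n-1}}\Big(\int_{S^{n-1}\cap\xi^\perp}f(x)\,dx\Big)\,d\mu(\xi)\qquad\text{for all } f\in C(S^{n-1}).$$ The function $\rho_K$ is a positive definite distribution on $\mathbb{R}^n$ if $\int_{\mathbb{R}^n}\rho_K\cdot(\varphi*\overline{\varphi(-\,\cdot\,)})\,dx\ge 0$ for every complex-valued Schwartz function $\varphi$ on $\mathbb{R}^n$. Theorem 4. (i) There is an origin-symmetric convex body in $\mathbb{R}^5$ that is not an intersection body. (ii) For $0<\varepsilon<1$ let $K_\varepsilon$ be the body of revolution $$K_\varepsilon=\Big\{x\in\mathbb{R}^5:\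 1-x_5^2-\varepsilon x_5^4\ge 0,\ \Big(\sum_{i=1}^4x_i^2\Big)^{1/2}\le(1-x_5^2-\varepsilon x_5^4)^{1/4}\Big\},$$ whose section at each height $x_5=z$ with $1-z^2-\varepsilon z^4\ge 0$ is a 4-dimensional ball of radius $(1-z^2-\varepsilon z^4)^{1/4}$. Then $K_\varepsilon$ is an origin-symmetric convex body. If $\frac34<\varepsilon<1$, then the radial function of $K_\varepsilon$ is not a positive definite distribution on $\mathbb{R}^5$, and $K_\varepsilon$ is not an intersection body. (iii) The answer to the Busemann-Petty problem is negative in every dimension $n\ge5$: for every $n\ge 5$ there are origin-symmetric convex bodies $K,L$ in $\mathbb{R}^n$ with $\mathrm{vol}_{n-1}(K\cap H)\le\mathrm{vol}_{n-1}(L\cap H)$ for every hyperplane $H$ through the origin, but $\mathrm{vol}_n(K)>\mathrm{vol}_n(L)$. -/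

import Mathlib

open MeasureTheory Metric
open scoped ComplexOrder ComplexConjugate SchwartzMap

noncomputable section

/-- The Euclidean space `ℝⁿ`. -/
abbrev E (n : ℕ) : Type := EuclideanSpace ℝ (Fin n)

/-- The unit sphere `Sⁿ⁻¹` of `ℝⁿ`. -/
abbrev S (n : ℕ) : Type := sphere (0 : E n) 1

/-- The hyperplane through the origin orthogonal to `ξ` (for `ξ ≠ 0`). It is a Euclidean space
of dimension `n - 1`, and `volume` on it is `(n - 1)`-dimensional Lebesgue measure. -/
abbrev hyperplane {n : ℕ} (ξ : E n) : Submodule ℝ (E n) := (Submodule.span ℝ {ξ})ᗮ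

/-- A convex body: a compact convex set with non-empty interior. -/
structure IsConvexBody {n : ℕ} (K : Set (E n)) : Prop where
  convex : Convex ℝ K
  isCompact : IsCompact K
  interior_nonempty : (interior K).Nonempty

/-- Symmetry with respect to the origin. -/
def IsOriginSymmetric {n : ℕ} (K : Set (E n)) : Prop := ∀ x ∈ K, -x ∈ K

/-- The radial function `ρ_K(x) = max {a > 0 : a x ∈ K}`, for `x ≠ 0`. -/
def radialFunction {n : ℕ} (K : Set (E n)) (x : E n) : ℝ := sSup {a : ℝ | 0 < a ∧ a • x ∈ K}

/-- The inclusion of the unit sphere `Sⁿ⁻¹ ∩ ξ^⊥` of the hyperplane `ξ^⊥` in `Sⁿ⁻¹`. -/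
def subsphereIncl {n : ℕ} (ξ : E n) (x : sphere (0 : hyperplane ξ) 1) : S n :=
  ⟨((x : hyperplane ξ) : E n), by
    have h := x.2
    rw [mem_sphere_zero_iff_norm] at h ⊢
    exact h⟩

/-- The spherical Radon transform `Rf(ξ) = ∫_{Sⁿ⁻¹ ∩ ξ^⊥} f(x) dx`. Here `volume.toSphere` is
the surface area measure of the unit sphere of the Euclidean space `ξ^⊥`. -/
def sphericalRadon {n : ℕ} (f : C(S n, ℝ)) (ξ : S n) : ℝ :=
  ∫ x : sphere (0 : hyperplane (ξ : E n)) 1, f (subsphereIncl (ξ : E n) x)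
    ∂((volume : Measure (hyperplane (ξ : E n))).toSphere)

/-- An origin-symmetric star body `K` is an intersection body if its radial function is the
spherical Radon transform `Rμ` of a finite Borel measure `μ` on the sphere, where `Rμ` is given
by `⟨Rμ, f⟩ = ∫ Rf dμ` for continuous `f`, and a function on the sphere is identified with its
product with the surface area measure. -/
def IsIntersectionBody {n : ℕ} (K : Set (E n)) : Prop :=
  ∃ μ : Measure (S n), IsFiniteMeasure μ ∧
    ∀ f : C(S n, ℝ),
      ∫ x : S n, radialFunction K (x : E n) * f x ∂((volume : Measure (E n)).toSphere)
        = ∫ ξ : S n, sphericalRadon f ξ ∂μ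

/-- Positive definiteness of the distribution `φ ↦ ∫ g φ` that is given by a (locally
integrable, tempered) function `g`: `⟨g, φ * conj (φ (-·))⟩ ≥ 0` for every Schwartz function
`φ`. The order on `ℂ` makes `0 ≤ z` mean that `z` is real and non-negative. -/
def IsPositiveDefiniteDistribution {n : ℕ} (g : E n → ℝ) : Prop :=
  ∀ φ : 𝓢(E n, ℂ),
    0 ≤ ∫ x : E n, (g x : ℂ) *
      convolution (fun y => φ y) (fun y => conj (φ (-y))) (ContinuousLinearMap.mul ℂ ℂ) volume x

/-- The affirmative answer to the Busemann-Petty problem in `ℝⁿ`: for origin-symmetric convex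
bodies `K`, `L`, if every section of `K` by a hyperplane through the origin has
`(n - 1)`-dimensional volume at most that of the section of `L`, then `vol K ≤ vol L`. -/
def BusemannPettyAffirmative (n : ℕ) : Prop :=
  ∀ K L : Set (E n), IsConvexBody K → IsOriginSymmetric K → IsConvexBody L → IsOriginSymmetric L →
    (∀ ξ : E n, ξ ≠ 0 →
      volume {x : hyperplane ξ | (x : E n) ∈ K} ≤ volume {x : hyperplane ξ | (x : E n) ∈ L}) →
    volume K ≤ volume L

/-- The body of revolution in `ℝ⁵` about the last coordinate axis whose section at height `z`
is the four-dimensional ball of radius `(1 - z² - ε z⁴)^(1/4)` if `1 - z² - ε z⁴ ≥ 0`, and empty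
otherwise. -/
def revolutionBody (ε : ℝ) : Set (E 5) :=
  {x | 0 ≤ 1 - x (Fin.last 4) ^ 2 - ε * x (Fin.last 4) ^ 4 ∧
    Real.sqrt (∑ i : Fin 4, x i.castSucc ^ 2)
      ≤ (1 - x (Fin.last 4) ^ 2 - ε * x (Fin.last 4) ^ 4) ^ (1 / 4 : ℝ)}

end

/-! Everything is driven by one test function. Split x = t e + y with e a unit vector and y
orthogonal to e, and let `testFun` be the fourth t-derivative of the Gaussian exp(-(t² + δ|y|²)/2),
that is, the Hermite polynomial t⁴ - 6t² + 3 times that Gaussian. Its Fourier transform is a fourth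
power times a Gaussian, hence non-negative. Two consequences are verified by direct Gaussian
computation. It is a positive multiple of φ * φ(-·) for a Schwartz function φ
(`exists_convolution_hermite`). Its integral over every hyperplane through the origin is
non-negative (`integral_hyperplane_testRay_nonneg`); in polar coordinates this says that its radial
integral `testRay` has a non-negative spherical Radon transform. Hence if ∫ ρ_K · `testFun` < 0,
then ρ_K is not positive definite and K is not an intersection body.

The sign of this integral is found by letting δ → 0 (`exists_integral_mul_testFun_neg`). For a body
of revolution in dimension j + 5, ρ = |t|⁻¹ b(|y|/|t|), and integration over y leaves a function of
t. The divergent part of s^(j+3) b(s), namely s^(j+2) + c s^j, contributes only multiples of 1 and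
t², which the Hermite weight annihilates. What survives is a positive constant times the convergent
integral of s^(j+3) b(s) - s^(j+2) - c s^j over the half-line. For `revolutionBody ε` it has an
explicit primitive and equals -√L (L - 3/2)/3 with L = (1 + √(1 + 4ε))/2, which is negative when ε >
3/4.

For Busemann-Petty, L is a smooth body whose squared gauge is that of an ℓ^(2n)-sum of a hyperplane
and a line plus τ|x|². For the ℓ^(2n)-sum b(s) < 1/s, so the integral is negative with c = 0, and it
stays negative for small τ. In dimension d, define K by ρ_K^(d-1) = ρ_L^(d-1) - η · `testRay`.
Central sections shrink because the Radon transform of `testRay` is non-negative; the volume grows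
by Bernoulli's inequality because ∫ ρ_L · `testRay` < 0. For small η the body K is still convex: its
squared gauge minus that of the ℓ^(2n)-sum is a C² perturbation of τ|x|². -/

/-! ### Splitting a Euclidean space into a line and its orthogonal complement. -/

section Decomposition

variable {V : Type*} [NormedAddCommGroup V] [InnerProductSpace ℝ V] [FiniteDimensional ℝ V]
  [MeasurableSpace V] [BorelSpace V]

theorem measurePreserving_lineProd {u : V} (hu : ‖u‖ = 1) :
    MeasurePreserving (fun p : ℝ × (Submodule.span ℝ {u})ᗮ => p.1 • u + (p.2 : V))
      (volume.prod volume) volume := by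
  have h1 := (LinearIsometryEquiv.toSpanUnitSingleton (𝕜 := ℝ) u hu).measurePreserving
  have h2 := h1.prod (MeasurePreserving.id (volume : Measure (Submodule.span ℝ {u})ᗮ))
  have h3 := (WithLp.volume_preserving_toLp (Submodule.span ℝ {u}) (Submodule.span ℝ {u})ᗮ)
  have h4 := (LinearIsometryEquiv.measurePreserving
    (Submodule.orthogonalDecomposition (Submodule.span ℝ {u})).symm)
  have := h4.comp (h3.comp h2)
  convert! this using 1

theorem measurableEmbedding_lineProd {u : V} (hu : ‖u‖ = 1) :
    MeasurableEmbedding (fun p : ℝ × (Submodule.span ℝ {u})ᗮ => p.1 • u + (p.2 : V)) := by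
  refine Continuous.measurableEmbedding (by fun_prop) ?_
  rintro ⟨t, y⟩ ⟨t', y'⟩ h
  simp only at h
  have hy : ∀ z : (Submodule.span ℝ {u})ᗮ, inner ℝ u (z : V) = 0 := fun z =>
    Submodule.mem_orthogonal_singleton_iff_inner_right.1 z.2
  have ht : t = t' := by
    have := congrArg (fun x => inner ℝ u x) h
    simpa [inner_add_right, inner_smul_right, hy, hu] using this
  subst ht
  simpa using h

theorem integral_lineProd {u : V} (hu : ‖u‖ = 1) (F : V → ℝ) :
    ∫ x, F x = ∫ p : ℝ × (Submodule.span ℝ {u})ᗮ, F (p.1 • u + (p.2 : V))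
      ∂(volume.prod volume) :=
  ((measurePreserving_lineProd hu).integral_comp (measurableEmbedding_lineProd hu) F).symm

omit [FiniteDimensional ℝ V] [MeasurableSpace V] [BorelSpace V] in
theorem inner_lineProd {u : V} (hu : ‖u‖ = 1) (t : ℝ) (y : (Submodule.span ℝ {u})ᗮ) :
    inner ℝ u (t • u + (y : V)) = t := by
  have hy : inner ℝ u (y : V) = 0 := Submodule.mem_orthogonal_singleton_iff_inner_right.1 y.2
  simp [inner_add_right, inner_smul_right, hy, hu]

omit [FiniteDimensional ℝ V] [MeasurableSpace V] [BorelSpace V] in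
theorem norm_sq_lineProd {u : V} (hu : ‖u‖ = 1) (t : ℝ) (y : (Submodule.span ℝ {u})ᗮ) :
    ‖t • u + (y : V)‖ ^ 2 = t ^ 2 + ‖y‖ ^ 2 := by
  have hy : inner ℝ u (y : V) = 0 := Submodule.mem_orthogonal_singleton_iff_inner_right.1 y.2
  rw [norm_add_sq_real, norm_smul, inner_smul_left, hy, hu]
  simp

end Decomposition

/-! ### Polar coordinates for integrable functions. -/

section Polar

variable {V : Type*} [NormedAddCommGroup V] [NormedSpace ℝ V] [FiniteDimensional ℝ V]
  [Nontrivial V] [MeasurableSpace V] [BorelSpace V]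

theorem integral_eq_integral_sphere (μ : Measure V) [μ.IsAddHaarMeasure] {F : V → ℝ}
    (hF : Integrable F μ) :
    ∫ x, F x ∂μ = ∫ θ : sphere (0 : V) 1,
      (∫ r in Set.Ioi (0 : ℝ), r ^ (Module.finrank ℝ V - 1) * F (r • (θ : V))) ∂μ.toSphere := by
  have hmp := μ.measurePreserving_homeomorphUnitSphereProd
  have hemb := (homeomorphUnitSphereProd V).measurableEmbedding
  have h1 : ∫ x, F x ∂μ = ∫ x : ({0}ᶜ : Set V), F x ∂(μ.comap (↑)) := by
    rw [integral_subtype_comap (measurableSet_singleton _).compl F, restrict_compl_singleton]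
  have hint : Integrable (fun x : ({0}ᶜ : Set V) => F x) (μ.comap (↑)) := by
    have := (integrableOn_iff_comap_subtypeVal (μ := μ) (f := F)
      (measurableSet_singleton (0 : V)).compl).1 hF.integrableOn
    exact this
  have h2 : ∫ x : ({0}ᶜ : Set V), F x ∂(μ.comap (↑)) =
      ∫ p, F (p.2.1 • (p.1 : V))
        ∂(μ.toSphere.prod (.volumeIoiPow (Module.finrank ℝ V - 1))) := by
    rw [← hmp.integral_comp hemb]
    refine integral_congr_ae (Filter.Eventually.of_forall fun x => ?_)
    have := (homeomorphUnitSphereProd V).symm_apply_apply x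
    have h := congrArg Subtype.val this
    rw [homeomorphUnitSphereProd_symm_apply_coe] at h
    simp only [h]
  have h3 : Integrable (fun p : sphere (0 : V) 1 × Set.Ioi (0 : ℝ) => F (p.2.1 • (p.1 : V)))
      (μ.toSphere.prod (.volumeIoiPow (Module.finrank ℝ V - 1))) := by
    rw [← hmp.integrable_comp_emb hemb]
    refine hint.congr (Filter.Eventually.of_forall fun x => ?_)
    have := (homeomorphUnitSphereProd V).symm_apply_apply x
    have h := congrArg Subtype.val this
    rw [homeomorphUnitSphereProd_symm_apply_coe] at h
    simp only [Function.comp_def, h]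
  rw [h1, h2, integral_prod _ h3]
  refine integral_congr_ae (Filter.Eventually.of_forall fun θ => ?_)
  simp only
  rw [Measure.volumeIoiPow, integral_withDensity_eq_integral_toReal_smul (by fun_prop) (by simp)]
  rw [integral_subtype_comap measurableSet_Ioi
    (fun a : ℝ => (ENNReal.ofReal (a ^ (Module.finrank ℝ V - 1))).toReal • F (a • (θ : V)))]
  refine setIntegral_congr_fun measurableSet_Ioi fun x hx => ?_
  have hx : 0 < x := hx
  simp only [smul_eq_mul]
  rw [ENNReal.toReal_ofReal (by positivity)]

end Polar

/-! ### Half-line Gaussian moments and the Hermite polynomial of degree four. -/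

section GaussianMoments

/-- The `k`-th moment of the standard Gaussian on the half-line. -/
noncomputable def gaussMoment (k : ℕ) : ℝ := ∫ r in Set.Ioi (0 : ℝ), r ^ k * Real.exp (-(r ^ 2 / 2))

theorem integrable_pow_mul_gauss (k : ℕ) {w : ℝ} (hw : 0 < w) :
    Integrable (fun r : ℝ => r ^ k * Real.exp (-(w * r ^ 2 / 2))) := by
  have := integrable_rpow_mul_exp_neg_mul_sq (b := w / 2) (by positivity) (s := k)
    (by have : (0 : ℝ) ≤ k := k.cast_nonneg
        linarith)
  refine this.congr (Filter.Eventually.of_forall fun r => ?_)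
  simp only [Real.rpow_natCast]
  ring_nf

theorem integral_pow_mul_gauss (k : ℕ) {w : ℝ} (hw : 0 < w) :
    ∫ r in Set.Ioi (0 : ℝ), r ^ k * Real.exp (-(w * r ^ 2 / 2)) =
      w ^ (-((k : ℝ) + 1) / 2) * gaussMoment k := by
  have h := integral_comp_mul_left_Ioi (fun r : ℝ => r ^ k * Real.exp (-(r ^ 2 / 2))) 0
    (Real.sqrt_pos.2 hw)
  rw [mul_zero, smul_eq_mul] at h
  have h2 : ∀ r : ℝ, (√w * r) ^ k * Real.exp (-((√w * r) ^ 2 / 2)) =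
      √w ^ k * (r ^ k * Real.exp (-(w * r ^ 2 / 2))) := fun r => by
    rw [mul_pow, mul_pow, Real.sq_sqrt hw.le]; ring
  simp only [h2] at h
  rw [integral_const_mul] at h
  have h3 : w ^ (-((k : ℝ) + 1) / 2) * (√w ^ k * √w) = 1 := by
    rw [← pow_succ, ← Real.rpow_natCast, Real.sqrt_eq_rpow, ← Real.rpow_mul hw.le,
      ← Real.rpow_add hw]
    push_cast
    ring_nf
    simp
  have hs : 0 < √w := Real.sqrt_pos.2 hw
  have h4 : √w ^ k * √w * ∫ r in Set.Ioi (0 : ℝ), r ^ k * Real.exp (-(w * r ^ 2 / 2)) =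
      gaussMoment k := by
    rw [gaussMoment]
    field_simp at h
    linear_combination h
  rw [← h4, ← mul_assoc, h3, one_mul]

theorem gaussMoment_pos (k : ℕ) : 0 < gaussMoment k := by
  rw [gaussMoment, integral_pos_iff_support_of_nonneg_ae]
  · have : Function.support (fun r : ℝ => r ^ k * Real.exp (-(r ^ 2 / 2))) ⊇ Set.Ioi 0 := by
      intro r hr
      have hr : (0 : ℝ) < r := hr
      simp only [Function.mem_support]
      positivity
    rw [Measure.restrict_apply₀' measurableSet_Ioi.nullMeasurableSet,
      Set.inter_eq_right.2 this]
    simp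
  · refine (ae_restrict_iff' measurableSet_Ioi).2 (Filter.Eventually.of_forall fun r hr => ?_)
    have hr : (0 : ℝ) < r := hr
    simp only [Pi.zero_apply]
    positivity
  · have := (integrable_pow_mul_gauss k one_pos).restrict (s := Set.Ioi 0)
    simpa using this

theorem gaussMoment_add_two (k : ℕ) : gaussMoment (k + 2) = (k + 1) * gaussMoment k := by
  have key : ∀ j : ℕ, gaussMoment j =
      (1 / 2 : ℝ) ^ (-((j : ℝ) + 1) / 2) * (1 / 2) * Real.Gamma (((j : ℝ) + 1) / 2) := by
    intro j
    have := integral_rpow_mul_exp_neg_mul_rpow (p := 2) (q := j) (b := 1 / 2) two_pos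
      (by have : (0 : ℝ) ≤ j := j.cast_nonneg
          linarith) (by norm_num)
    rw [← this, gaussMoment]
    refine setIntegral_congr_fun measurableSet_Ioi fun r hr => ?_
    simp only [Real.rpow_natCast]
    norm_num
    ring_nf
    simp
  rw [key, key]
  have h1 : (((k + 2 : ℕ) : ℝ) + 1) / 2 = ((k : ℝ) + 1) / 2 + 1 := by push_cast; ring
  have h2 : -(((k + 2 : ℕ) : ℝ) + 1) / 2 = -((k : ℝ) + 1) / 2 - 1 := by push_cast; ring
  rw [h1, h2, Real.Gamma_add_one (by positivity), Real.rpow_sub_one (by norm_num)]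
  ring

/-- Two specialisations carry the argument. For k = 0 the last factor is the perfect square 3(1 -
t²/w)²; for t = w = 1 it is k(k - 2), which vanishes at k = 0 and k = 2 and is positive for k ≥ 3.
-/
theorem integral_pow_mul_quartic_gauss (k : ℕ) {w : ℝ} (hw : 0 < w) (t : ℝ) :
    ∫ r in Set.Ioi (0 : ℝ), r ^ k * (((r * t) ^ 4 - 6 * (r * t) ^ 2 + 3)
      * Real.exp (-(w * r ^ 2 / 2))) =
      gaussMoment k * w ^ (-((k : ℝ) + 1) / 2) *
        ((k + 1) * (k + 3) * (t ^ 2 / w) ^ 2 - 6 * (k + 1) * (t ^ 2 / w) + 3) := by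
  have hi := fun j : ℕ => (integrable_pow_mul_gauss j hw).integrableOn (s := Set.Ioi 0)
  have h : ∀ r : ℝ, r ^ k * (((r * t) ^ 4 - 6 * (r * t) ^ 2 + 3) * Real.exp (-(w * r ^ 2 / 2)))
      = t ^ 4 * (r ^ (k + 2 + 2) * Real.exp (-(w * r ^ 2 / 2)))
        - 6 * t ^ 2 * (r ^ (k + 2) * Real.exp (-(w * r ^ 2 / 2)))
        + 3 * (r ^ k * Real.exp (-(w * r ^ 2 / 2))) := fun r => by ring
  simp only [h]
  have ha := (hi (k + 2 + 2)).const_mul (t ^ 4)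
  have hb := (hi (k + 2)).const_mul (6 * t ^ 2)
  rw [integral_add (by exact ha.sub hb) (by exact (hi k).const_mul 3),
    integral_sub (by exact ha) (by exact hb), integral_const_mul, integral_const_mul, integral_const_mul,
    integral_pow_mul_gauss _ hw,
    integral_pow_mul_gauss _ hw, integral_pow_mul_gauss _ hw, gaussMoment_add_two,
    gaussMoment_add_two]
  have h1 : -(((k + 2 : ℕ) : ℝ) + 1) / 2 = -((k : ℝ) + 1) / 2 - 1 := by push_cast; ring
  have h2 : -(((k + 2 + 2 : ℕ) : ℝ) + 1) / 2 = -((k : ℝ) + 1) / 2 - 1 - 1 := by push_cast; ring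
  rw [h1, h2, Real.rpow_sub_one hw.ne', Real.rpow_sub_one hw.ne']
  push_cast
  field_simp
  ring

end GaussianMoments

/-! ### The test function, its ray integrals, and the sign of its total integral. -/

section TestFunction

variable {V : Type*} [NormedAddCommGroup V] [InnerProductSpace ℝ V]

/-- The quadratic form `⟨e, x⟩² + δ (|x|² - ⟨e, x⟩²)`. -/
noncomputable def spheroidForm (δ : ℝ) (e x : V) : ℝ :=
  inner ℝ e x ^ 2 + δ * (‖x‖ ^ 2 - inner ℝ e x ^ 2)

/-- The fourth derivative in the direction `e` of a Gaussian with axis `e`. -/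
noncomputable def testFun (δ : ℝ) (e x : V) : ℝ :=
  (inner ℝ e x ^ 4 - 6 * inner ℝ e x ^ 2 + 3) * Real.exp (-(spheroidForm δ e x / 2))

/-- The integral of `testFun` over the ray through `x` with weight `r ^ k`. -/
noncomputable def testRay (k : ℕ) (δ : ℝ) (e x : V) : ℝ :=
  gaussMoment k * spheroidForm δ e x ^ (-((k : ℝ) + 1) / 2) *
    ((k + 1) * (k + 3) * (inner ℝ e x ^ 2 / spheroidForm δ e x) ^ 2
      - 6 * (k + 1) * (inner ℝ e x ^ 2 / spheroidForm δ e x) + 3)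

theorem spheroidForm_smul (δ : ℝ) (e x : V) (r : ℝ) :
    spheroidForm δ e (r • x) = r ^ 2 * spheroidForm δ e x := by
  simp only [spheroidForm, inner_smul_right, norm_smul, mul_pow, Real.norm_eq_abs, sq_abs]
  ring

theorem inner_sq_le_norm_sq {e : V} (he : ‖e‖ ≤ 1) (x : V) : inner ℝ e x ^ 2 ≤ ‖x‖ ^ 2 := by
  have h : |inner ℝ e x| ≤ ‖x‖ := (abs_real_inner_le_norm e x).trans
    (mul_le_of_le_one_left (norm_nonneg _) he)
  exact sq_le_sq' (abs_le.1 h).1 (abs_le.1 h).2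

theorem le_spheroidForm {δ : ℝ} (hδ : δ ≤ 1) (e x : V) :
    δ * ‖x‖ ^ 2 ≤ spheroidForm δ e x := by
  rw [spheroidForm]
  nlinarith [sq_nonneg (inner ℝ e x), mul_nonneg (sub_nonneg.2 hδ) (sq_nonneg (inner ℝ e x))]

theorem spheroidForm_pos {δ : ℝ} (hδ0 : 0 < δ) (hδ : δ ≤ 1) (e : V) {x : V} (hx : x ≠ 0) :
    0 < spheroidForm δ e x := by
  have : 0 < ‖x‖ := norm_pos_iff.2 hx
  exact (by positivity : 0 < δ * ‖x‖ ^ 2).trans_le (le_spheroidForm hδ e x)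

theorem integral_ray_testFun (k : ℕ) {δ : ℝ} (hδ0 : 0 < δ) (hδ : δ ≤ 1) (e : V) {x : V}
    (hx : x ≠ 0) :
    ∫ r in Set.Ioi (0 : ℝ), r ^ k * testFun δ e (r • x) = testRay k δ e x := by
  rw [testRay, ← integral_pow_mul_quartic_gauss k (spheroidForm_pos hδ0 hδ e hx)]
  refine setIntegral_congr_fun measurableSet_Ioi fun r _ => ?_
  simp only [testFun, spheroidForm_smul, inner_smul_right]
  ring_nf

theorem abs_testFun_le {δ : ℝ} (hδ : δ ≤ 1) {e : V} (he : ‖e‖ ≤ 1) (x : V) :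
    |testFun δ e x| ≤ (‖x‖ ^ 4 + 6 * ‖x‖ ^ 2 + 3) * Real.exp (-(δ * ‖x‖ ^ 2 / 2)) := by
  rw [testFun, abs_mul, Real.abs_exp]
  have h1 := inner_sq_le_norm_sq he x
  have h2 := le_spheroidForm hδ e x
  refine mul_le_mul ?_ (Real.exp_le_exp.2 (by linarith)) (Real.exp_pos _).le (by positivity)
  rw [abs_le]
  constructor <;> nlinarith [sq_nonneg (inner ℝ e x), sq_nonneg ‖x‖, pow_le_pow_left₀
    (sq_nonneg (inner ℝ e x)) h1 2]

theorem continuous_testFun (δ : ℝ) (e : V) : Continuous (testFun δ e) := by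
  unfold testFun spheroidForm
  fun_prop

variable [FiniteDimensional ℝ V] [MeasurableSpace V] [BorelSpace V]

/-- Vectors `e` of norm less than 1 are allowed because the restriction of `testFun` to a hyperplane
is again a `testFun`, with `e` replaced by its orthogonal projection. The integral factors along the
line through `e` and its complement. -/
theorem integral_testFun_nonneg {δ : ℝ} (hδ0 : 0 < δ) {e : V} (he : ‖e‖ ≤ 1) :
    0 ≤ ∫ x, testFun δ e x := by
  rcases eq_or_ne e 0 with rfl | he0
  · refine integral_nonneg fun x => ?_
    simp only [testFun, inner_zero_left]
    positivity
  have hs : 0 < ‖e‖ := norm_pos_iff.2 he0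
  set s := ‖e‖ with hsdef
  set u : V := s⁻¹ • e with hu
  have hu1 : ‖u‖ = 1 := by
    rw [hu, norm_smul, norm_inv, norm_norm, inv_mul_cancel₀ hs.ne']
  have heu : e = s • u := by rw [hu, smul_smul, mul_inv_cancel₀ hs.ne', one_smul]
  have hs2 : s ^ 2 ≤ 1 := by nlinarith
  set w := s ^ 2 + δ * (1 - s ^ 2) with hw
  have hwpos : 0 < w := by
    have : 0 ≤ δ * (1 - s ^ 2) := mul_nonneg hδ0.le (by linarith)
    positivity
  rw [integral_lineProd hu1]
  have hsplit : ∀ p : ℝ × (Submodule.span ℝ {u})ᗮ, testFun δ e (p.1 • u + (p.2 : V)) =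
      (((p.1 * s) ^ 4 - 6 * (p.1 * s) ^ 2 + 3) * Real.exp (-(w * p.1 ^ 2 / 2))) *
        Real.exp (-(δ * ‖p.2‖ ^ 2 / 2)) := by
    intro p
    have h1 : inner ℝ e (p.1 • u + (p.2 : V)) = p.1 * s := by
      rw [heu, inner_smul_left, inner_lineProd hu1]
      simp [mul_comm]
    rw [testFun, spheroidForm, h1, norm_sq_lineProd hu1, mul_assoc, ← Real.exp_add, hw]
    ring_nf
  simp_rw [hsplit]
  rw [integral_prod_mul (fun t : ℝ => ((t * s) ^ 4 - 6 * (t * s) ^ 2 + 3)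
    * Real.exp (-(w * t ^ 2 / 2))) (fun y : (Submodule.span ℝ {u})ᗮ =>
      Real.exp (-(δ * ‖y‖ ^ 2 / 2)))]
  refine mul_nonneg ?_ (integral_nonneg fun y => (Real.exp_pos _).le)
  have habs := integral_comp_abs (f := fun t : ℝ => ((t * s) ^ 4 - 6 * (t * s) ^ 2 + 3)
    * Real.exp (-(w * t ^ 2 / 2)))
  have h4 : ∀ t : ℝ, |t| ^ 4 = t ^ 4 := fun t => by
    rw [show (4 : ℕ) = 2 * 2 from rfl, pow_mul, sq_abs, pow_mul]
  simp only [mul_pow, sq_abs, h4] at habs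
  simp only [mul_pow]
  rw [habs]
  have := integral_pow_mul_quartic_gauss 0 hwpos s
  simp only [pow_zero, one_mul, mul_pow] at this
  rw [this]
  have hg := gaussMoment_pos 0
  have hr : 0 < w ^ (-(((0 : ℕ) : ℝ) + 1) / 2) := Real.rpow_pos_of_pos hwpos _
  -- The one-dimensional factor is a perfect square, which is where non-negativity comes from.
  have : (((0 : ℕ) : ℝ) + 1) * (((0 : ℕ) : ℝ) + 3) * (s ^ 2 / w) ^ 2
      - 6 * (((0 : ℕ) : ℝ) + 1) * (s ^ 2 / w) + 3 = 3 * (1 - s ^ 2 / w) ^ 2 := by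
    push_cast
    ring
  rw [this]
  positivity

end TestFunction

/-! ### Passing between integrals over the space and over the sphere. -/

section SphereIntegrals

variable {V : Type*} [NormedAddCommGroup V] [InnerProductSpace ℝ V] [FiniteDimensional ℝ V]
  [MeasurableSpace V] [BorelSpace V]

theorem integrable_mul_testFun {k : ℕ} (hd : Module.finrank ℝ V = k + 2) {δ : ℝ} (hδ0 : 0 < δ)
    (hδ : δ ≤ 1) {e : V} (he : ‖e‖ ≤ 1) {ρ : V → ℝ} (hρ : AEStronglyMeasurable ρ volume) {C : ℝ}
    (hC : ∀ x, |ρ x| ≤ C * ‖x‖⁻¹) : Integrable (fun x => ρ x * testFun δ e x) := by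
  have : Nontrivial V := Module.nontrivial_of_finrank_pos (R := ℝ) (by omega)
  have hb : Integrable (fun x : V => (fun r : ℝ => C * r⁻¹ * ((r ^ 4 + 6 * r ^ 2 + 3)
      * Real.exp (-(δ * r ^ 2 / 2)))) ‖x‖) := by
    rw [integrable_fun_norm_addHaar (μ := (volume : Measure V))
      (f := fun r : ℝ => C * r⁻¹ * ((r ^ 4 + 6 * r ^ 2 + 3) * Real.exp (-(δ * r ^ 2 / 2)))), hd]
    have hi := fun j : ℕ => (integrable_pow_mul_gauss j hδ0).integrableOn (s := Set.Ioi 0)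
    refine IntegrableOn.congr_fun ((((hi (k + 4)).add ((hi (k + 2)).const_mul 6)).add
      ((hi k).const_mul 3)).const_mul C) (fun r hr => ?_) measurableSet_Ioi
    have hr : (0 : ℝ) < r := hr
    simp only [smul_eq_mul, Pi.add_apply, show k + 2 - 1 = k + 1 from rfl]
    field_simp
    ring
  refine hb.mono' (hρ.mul (continuous_testFun δ e).aestronglyMeasurable)
    (Filter.Eventually.of_forall fun x => ?_)
  rw [Real.norm_eq_abs, abs_mul]
  exact mul_le_mul (hC x) (abs_testFun_le hδ he x) (abs_nonneg _) ((abs_nonneg _).trans (hC x))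

/-- The polar weight r^(k+1) in dimension k + 2 loses one power to the homogeneity of ρ, leaving
r^k. This is also the polar weight on a hyperplane, so the same `testRay k` serves in both places.
-/
theorem integral_mul_testFun_eq_sphere {k : ℕ} (hd : Module.finrank ℝ V = k + 2) {δ : ℝ}
    (hδ0 : 0 < δ) (hδ : δ ≤ 1) {e : V} (he : ‖e‖ ≤ 1) {ρ : V → ℝ}
    (hρ : AEStronglyMeasurable ρ volume) {C : ℝ} (hC : ∀ x, |ρ x| ≤ C * ‖x‖⁻¹)
    (hhom : ∀ (r : ℝ) (x : V), 0 < r → ρ (r • x) = r⁻¹ * ρ x) :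
    ∫ x, ρ x * testFun δ e x =
      ∫ θ : sphere (0 : V) 1, ρ θ * testRay k δ e (θ : V) ∂(volume : Measure V).toSphere := by
  have : Nontrivial V := Module.nontrivial_of_finrank_pos (R := ℝ) (by omega)
  rw [integral_eq_integral_sphere volume (integrable_mul_testFun hd hδ0 hδ he hρ hC)]
  refine integral_congr_ae (Filter.Eventually.of_forall fun θ => ?_)
  have hθ : (θ : V) ≠ 0 := ne_zero_of_mem_unit_sphere θ
  beta_reduce
  rw [← integral_ray_testFun k hδ0 hδ e hθ, ← integral_const_mul]
  refine setIntegral_congr_fun measurableSet_Ioi fun r hr => ?_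
  have hr : (0 : ℝ) < r := hr
  rw [hhom r _ hr, hd, show k + 2 - 1 = k + 1 from rfl, pow_succ]
  field_simp

theorem integrable_testFun {k : ℕ} (hd : Module.finrank ℝ V = k + 1) {δ : ℝ} (hδ0 : 0 < δ)
    (hδ : δ ≤ 1) {e : V} (he : ‖e‖ ≤ 1) : Integrable (testFun δ e) := by
  have : Nontrivial V := Module.nontrivial_of_finrank_pos (R := ℝ) (by omega)
  have hb : Integrable (fun x : V => (fun r : ℝ => ((r ^ 4 + 6 * r ^ 2 + 3)
      * Real.exp (-(δ * r ^ 2 / 2)))) ‖x‖) := by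
    rw [integrable_fun_norm_addHaar (μ := (volume : Measure V))
      (f := fun r : ℝ => ((r ^ 4 + 6 * r ^ 2 + 3) * Real.exp (-(δ * r ^ 2 / 2)))), hd]
    have hi := fun j : ℕ => (integrable_pow_mul_gauss j hδ0).integrableOn (s := Set.Ioi 0)
    refine IntegrableOn.congr_fun (((hi (k + 4)).add ((hi (k + 2)).const_mul 6)).add
      ((hi k).const_mul 3)) (fun r hr => ?_) measurableSet_Ioi
    simp only [smul_eq_mul, Pi.add_apply, show k + 1 - 1 = k from rfl]
    ring
  exact hb.mono' (continuous_testFun δ e).aestronglyMeasurable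
    (Filter.Eventually.of_forall fun x => abs_testFun_le hδ he x)

theorem integral_testFun_eq_sphere {k : ℕ} (hd : Module.finrank ℝ V = k + 1) {δ : ℝ}
    (hδ0 : 0 < δ) (hδ : δ ≤ 1) {e : V} (he : ‖e‖ ≤ 1) :
    ∫ x, testFun δ e x =
      ∫ θ : sphere (0 : V) 1, testRay k δ e (θ : V) ∂(volume : Measure V).toSphere := by
  have : Nontrivial V := Module.nontrivial_of_finrank_pos (R := ℝ) (by omega)
  rw [integral_eq_integral_sphere volume (integrable_testFun hd hδ0 hδ he)]
  refine integral_congr_ae (Filter.Eventually.of_forall fun θ => ?_)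
  have hθ : (θ : V) ≠ 0 := ne_zero_of_mem_unit_sphere θ
  beta_reduce
  rw [← integral_ray_testFun k hδ0 hδ e hθ, hd]
  rfl

theorem integral_sphere_testRay_nonneg {k : ℕ} (hd : Module.finrank ℝ V = k + 1) {δ : ℝ}
    (hδ0 : 0 < δ) (hδ : δ ≤ 1) {e : V} (he : ‖e‖ ≤ 1) :
    0 ≤ ∫ θ : sphere (0 : V) 1, testRay k δ e (θ : V) ∂(volume : Measure V).toSphere := by
  rw [← integral_testFun_eq_sphere hd hδ0 hδ he]
  exact integral_testFun_nonneg hδ0 he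

omit [FiniteDimensional ℝ V] [MeasurableSpace V] [BorelSpace V] in
-- On a subspace the form sees `e` only through inner products with vectors of that subspace.
theorem spheroidForm_subspace (U : Submodule ℝ V) [U.HasOrthogonalProjection] (δ : ℝ) (e : V)
    (x : U) : spheroidForm δ e (x : V) = spheroidForm δ (U.orthogonalProjectionOnto e) x := by
  simp only [spheroidForm, Submodule.coe_norm]
  rw [show inner ℝ (U.orthogonalProjectionOnto e) x = inner ℝ e (x : V) from
    Submodule.inner_orthogonalProjectionOnto_eq_of_mem_right x e]

omit [FiniteDimensional ℝ V] [MeasurableSpace V] [BorelSpace V] in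
theorem testRay_subspace (U : Submodule ℝ V) [U.HasOrthogonalProjection] (k : ℕ) (δ : ℝ) (e : V)
    (x : U) : testRay k δ e (x : V) = testRay k δ (U.orthogonalProjectionOnto e) x := by
  simp only [testRay, spheroidForm_subspace]
  rw [show inner ℝ (U.orthogonalProjectionOnto e) x = inner ℝ e (x : V) from
    Submodule.inner_orthogonalProjectionOnto_eq_of_mem_right x e]

omit [FiniteDimensional ℝ V] [MeasurableSpace V] [BorelSpace V] in
theorem continuousOn_testRay (k : ℕ) {δ : ℝ} (hδ0 : 0 < δ) (hδ : δ ≤ 1) (e : V) :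
    ContinuousOn (testRay k δ e) {0}ᶜ := by
  have hw : ContinuousOn (spheroidForm δ e) {0}ᶜ := by
    unfold spheroidForm
    fun_prop
  have hpos : ∀ x ∈ ({0}ᶜ : Set V), spheroidForm δ e x ≠ 0 := fun x hx =>
    (spheroidForm_pos hδ0 hδ e hx).ne'
  have hd : ContinuousOn (fun x : V => inner ℝ e x ^ 2 / spheroidForm δ e x) {0}ᶜ :=
    ContinuousOn.div (by fun_prop) hw hpos
  have hr : ContinuousOn (fun x : V => spheroidForm δ e x ^ (-((k : ℝ) + 1) / 2)) {0}ᶜ :=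
    hw.rpow_const fun x hx => Or.inl (hpos x hx)
  unfold testRay
  exact (continuousOn_const.mul hr).mul
    (((continuousOn_const.mul (hd.pow 2)).sub (continuousOn_const.mul hd)).add continuousOn_const)

end SphereIntegrals

/-! ### The obstruction to being an intersection body. -/

section IntersectionBody

theorem finrank_hyperplane {n : ℕ} {ξ : E (n + 1)} (hξ : ξ ≠ 0) :
    Module.finrank ℝ (hyperplane ξ) = n := by
  have h : _ + Module.finrank ℝ (hyperplane ξ) = _ :=
    Submodule.finrank_add_finrank_orthogonal (Submodule.span ℝ {ξ})
  rw [finrank_span_singleton hξ, finrank_euclideanSpace_fin] at h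
  omega

theorem integral_hyperplane_testRay_nonneg {k : ℕ} {δ : ℝ} (hδ0 : 0 < δ) (hδ : δ ≤ 1)
    {e : E (k + 2)} (he : ‖e‖ ≤ 1) {ξ : E (k + 2)} (hξ : ξ ≠ 0) :
    0 ≤ ∫ x : sphere (0 : hyperplane ξ) 1, testRay k δ e ((x : hyperplane ξ) : E (k + 2))
      ∂((volume : Measure (hyperplane ξ)).toSphere) := by
  simp only [testRay_subspace]
  exact integral_sphere_testRay_nonneg (finrank_hyperplane hξ) hδ0 hδ
    (((hyperplane ξ).norm_orthogonalProjectionOnto_apply_le e).trans he)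

/-- Apply the defining identity to f = `testRay`: the left side is the negative integral, while the
right side integrates a non-negative Radon transform against a measure. -/
theorem not_isIntersectionBody_of_integral_neg {k : ℕ} {K : Set (E (k + 2))} {ρ : E (k + 2) → ℝ}
    (hK : ∀ x, x ≠ 0 → radialFunction K x = ρ x) (hρ : AEStronglyMeasurable ρ volume) {C : ℝ}
    (hC : ∀ x, |ρ x| ≤ C * ‖x‖⁻¹)
    (hhom : ∀ (r : ℝ) (x : E (k + 2)), 0 < r → ρ (r • x) = r⁻¹ * ρ x)
    {δ : ℝ} (hδ0 : 0 < δ) (hδ : δ ≤ 1) {e : E (k + 2)} (he : ‖e‖ ≤ 1)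
    (hneg : ∫ x, ρ x * testFun δ e x < 0) : ¬ IsIntersectionBody K := by
  rintro ⟨μ, -, h⟩
  let f : C(S (k + 2), ℝ) := ⟨fun θ => testRay k δ e (θ : E (k + 2)),
    (continuousOn_testRay k hδ0 hδ e).comp_continuous continuous_subtype_val
      fun θ => ne_zero_of_mem_unit_sphere θ⟩
  have hf := h f
  have hR : ∀ ξ : S (k + 2), 0 ≤ sphericalRadon f ξ := fun ξ =>
    integral_hyperplane_testRay_nonneg hδ0 hδ he (ne_zero_of_mem_unit_sphere ξ)
  rw [integral_mul_testFun_eq_sphere finrank_euclideanSpace_fin hδ0 hδ he hρ hC hhom] at hneg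
  have : ∫ x : S (k + 2), radialFunction K (x : E (k + 2)) * f x
      ∂((volume : Measure (E (k + 2))).toSphere) < 0 := by
    convert! hneg using 2
    ext θ
    rw [hK _ (ne_zero_of_mem_unit_sphere θ)]
    rfl
  rw [hf] at this
  exact this.not_ge (integral_nonneg hR)

end IntersectionBody

/-! ### The limit δ → 0 and reduction to a one-dimensional integral. -/

section Limit

/-- The zeros at k = 0 and k = 2 express orthogonality of the Hermite polynomial to 1 and t². Odd
powers |t|^k are not polynomials, and those with k ≥ 3 give a positive value. -/
theorem integral_quartic_gauss_mul_abs_pow (k : ℕ) :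
    ∫ t : ℝ, (t ^ 4 - 6 * t ^ 2 + 3) * Real.exp (-(t ^ 2 / 2)) * |t| ^ k =
      2 * (gaussMoment k * (k * (k - 2))) := by
  have habs := integral_comp_abs
    (f := fun t : ℝ => t ^ k * ((t ^ 4 - 6 * t ^ 2 + 3) * Real.exp (-(t ^ 2 / 2))))
  have h4 : ∀ t : ℝ, |t| ^ 4 = t ^ 4 := fun t => by
    rw [show (4 : ℕ) = 2 * 2 from rfl, pow_mul, sq_abs, pow_mul]
  simp only [sq_abs, h4] at habs
  have := integral_pow_mul_quartic_gauss k one_pos 1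
  simp only [mul_one, one_mul, Real.one_rpow, one_pow, div_one] at this
  rw [this] at habs
  calc _ = ∫ t : ℝ, |t| ^ k * ((t ^ 4 - 6 * t ^ 2 + 3) * Real.exp (-(t ^ 2 / 2))) := by
        congr 1; ext t; ring
    _ = _ := by rw [habs]; ring

theorem integrable_quartic_gauss_mul_abs_pow (k : ℕ) :
    Integrable (fun t : ℝ => (t ^ 4 - 6 * t ^ 2 + 3) * Real.exp (-(t ^ 2 / 2)) * |t| ^ k) := by
  have hi := fun j : ℕ => (integrable_pow_mul_gauss j one_pos).abs
  have hb := ((hi (k + 4)).add ((hi (k + 2)).const_mul 6)).add ((hi k).const_mul 3)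
  refine hb.mono' (by fun_prop) (Filter.Eventually.of_forall fun t => ?_)
  simp only [Pi.add_apply, abs_mul, abs_pow, Real.abs_exp, one_mul, norm_mul, Real.norm_eq_abs,
    abs_abs]
  have : |t ^ 4 - 6 * t ^ 2 + 3| ≤ |t| ^ 4 + 6 * |t| ^ 2 + 3 := by
    have h4 : |t| ^ 4 = t ^ 4 := by
      rw [show (4 : ℕ) = 2 * 2 from rfl, pow_mul, sq_abs, pow_mul]
    rw [abs_le, sq_abs, h4]
    constructor <;> nlinarith [sq_nonneg t, sq_nonneg (t ^ 2)]
  calc _ ≤ (|t| ^ 4 + 6 * |t| ^ 2 + 3) * Real.exp (-(t ^ 2 / 2)) * |t| ^ k := by gcongr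
    _ = _ := by ring

variable {V : Type*} [NormedAddCommGroup V] [InnerProductSpace ℝ V] [FiniteDimensional ℝ V]
  [MeasurableSpace V] [BorelSpace V]

/-- Rescale y by |t|, use polar coordinates, and subtract s^(j+2) + c s^j from s^(j+3) b(s). The
subtracted Gaussian moments blow up as δ → 0, but scaling makes their contributions exactly
proportional to 1 and t². -/
theorem integral_radial_mul_gauss {W : Type*} [NormedAddCommGroup W] [InnerProductSpace ℝ W]
    [FiniteDimensional ℝ W] [MeasurableSpace W] [BorelSpace W] {j : ℕ}
    (hW : Module.finrank ℝ W = j + 4) {b : ℝ → ℝ} {c : ℝ}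
    (hB : IntegrableOn (fun s => s ^ (j + 3) * b s - s ^ (j + 2) - c * s ^ j) (Set.Ioi 0))
    {δ : ℝ} (hδ : 0 < δ) {t : ℝ} (ht : t ≠ 0) :
    ∫ y : W, |t|⁻¹ * b (‖y‖ / |t|) * Real.exp (-(δ * ‖y‖ ^ 2 / 2)) =
      ((j + 4 : ℕ) * volume.real (ball (0 : W) 1)) * (|t| ^ (j + 3) *
        (∫ s in Set.Ioi (0 : ℝ), (s ^ (j + 3) * b s - s ^ (j + 2) - c * s ^ j) *
          Real.exp (-(δ * t ^ 2 * s ^ 2 / 2)))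
        + (δ ^ (-((j : ℝ) + 3) / 2) * gaussMoment (j + 2)
          + c * δ ^ (-((j : ℝ) + 1) / 2) * gaussMoment j * t ^ 2)) := by
  have ht' : 0 < |t| := abs_pos.2 ht
  have : Nontrivial W := Module.nontrivial_of_finrank_pos (R := ℝ) (by omega)
  have hscale := Measure.integral_comp_smul (volume : Measure W)
    (fun y : W => |t|⁻¹ * b (‖y‖ / |t|) * Real.exp (-(δ * ‖y‖ ^ 2 / 2))) |t|
  rw [hW, abs_inv, abs_pow, abs_abs, smul_eq_mul] at hscale
  have h1 : ∫ y : W, |t|⁻¹ * b (‖y‖ / |t|) * Real.exp (-(δ * ‖y‖ ^ 2 / 2)) =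
      |t| ^ (j + 3) * ∫ y : W, b ‖y‖ * Real.exp (-(δ * t ^ 2 * ‖y‖ ^ 2 / 2)) := by
    have : ∀ y : W, |t|⁻¹ * b (‖|t| • y‖ / |t|) * Real.exp (-(δ * ‖|t| • y‖ ^ 2 / 2)) =
        |t|⁻¹ * (b ‖y‖ * Real.exp (-(δ * t ^ 2 * ‖y‖ ^ 2 / 2))) := by
      intro y
      rw [norm_smul, Real.norm_eq_abs, abs_abs, mul_pow, sq_abs, mul_div_cancel_left₀ _ ht'.ne']
      ring_nf
    simp only [this] at hscale
    rw [integral_const_mul] at hscale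
    rw [eq_comm, inv_mul_eq_iff_eq_mul₀ (by positivity)] at hscale
    rw [hscale, pow_succ]
    field_simp
  rw [h1, integral_fun_norm_addHaar volume
    (fun r => b r * Real.exp (-(δ * t ^ 2 * r ^ 2 / 2))), hW]
  simp only [nsmul_eq_mul, smul_eq_mul]
  have hw : 0 < δ * t ^ 2 := by positivity
  have hi := fun i : ℕ => (integrable_pow_mul_gauss i hw).integrableOn (s := Set.Ioi 0)
  have hBe : IntegrableOn (fun s => (s ^ (j + 3) * b s - s ^ (j + 2) - c * s ^ j) *
      Real.exp (-(δ * t ^ 2 * s ^ 2 / 2))) (Set.Ioi 0) := by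
    refine hB.mul_bdd (c := 1) (by fun_prop) (Filter.Eventually.of_forall fun s => ?_)
    rw [Real.norm_eq_abs, Real.abs_exp, Real.exp_le_one_iff]
    have : 0 ≤ δ * t ^ 2 * s ^ 2 / 2 := by positivity
    linarith
  have h2 : ∫ s in Set.Ioi (0 : ℝ), s ^ (j + 4 - 1) * (b s * Real.exp (-(δ * t ^ 2 * s ^ 2 / 2))) =
      (∫ s in Set.Ioi (0 : ℝ), (s ^ (j + 3) * b s - s ^ (j + 2) - c * s ^ j) *
          Real.exp (-(δ * t ^ 2 * s ^ 2 / 2)))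
        + ((δ * t ^ 2) ^ (-(((j + 2 : ℕ) : ℝ) + 1) / 2) * gaussMoment (j + 2)
          + c * ((δ * t ^ 2) ^ (-((j : ℝ) + 1) / 2) * gaussMoment j)) := by
    rw [← integral_pow_mul_gauss _ hw, ← integral_pow_mul_gauss _ hw, ← integral_const_mul,
      ← integral_add (by exact hi (j + 2)) (by exact (hi j).const_mul c),
      ← integral_add (by exact hBe) (by exact (hi (j + 2)).add ((hi j).const_mul c))]
    refine setIntegral_congr_fun measurableSet_Ioi fun s _ => ?_
    simp only [show j + 4 - 1 = j + 3 from rfl]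
    ring
  have h3 : ∀ a : ℝ, (δ * t ^ 2) ^ (a / 2) = δ ^ (a / 2) * |t| ^ a := fun a => by
    rw [Real.mul_rpow hδ.le (sq_nonneg t), ← sq_abs t, ← Real.rpow_natCast, ← Real.rpow_mul ht'.le]
    congr 2
    push_cast
    ring
  have h4 : |t| ^ (j + 3) * |t| ^ (-(((j + 2 : ℕ) : ℝ) + 1)) = 1 := by
    rw [← Real.rpow_natCast, ← Real.rpow_add ht']
    push_cast
    ring_nf
    simp
  have h5 : |t| ^ (j + 3) * |t| ^ (-((j : ℝ) + 1)) = t ^ 2 := by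
    rw [← Real.rpow_natCast, ← Real.rpow_add ht', ← sq_abs t, ← Real.rpow_natCast]
    push_cast
    ring_nf
  rw [h2, h3, h3]
  have h6 : -(((j + 2 : ℕ) : ℝ) + 1) / 2 = -((j : ℝ) + 3) / 2 := by push_cast; ring
  rw [← h6]
  linear_combination ((j + 4 : ℕ) : ℝ) * volume.real (ball (0 : W) 1) *
    (δ ^ (-(((j + 2 : ℕ) : ℝ) + 1) / 2) * gaussMoment (j + 2)) * h4 +
    ((j + 4 : ℕ) : ℝ) * volume.real (ball (0 : W) 1) *
    (c * δ ^ (-((j : ℝ) + 1) / 2) * gaussMoment j) * h5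

/-- Integrability of B(s) = s^(j+3) b(s) - s^(j+2) - c s^j lets dominated convergence replace the
Gaussian cutoff by 1. The sign of the limit is that of ∫ B, so a sufficiently small δ works. -/
theorem exists_integral_mul_testFun_neg {j : ℕ} (hd : Module.finrank ℝ V = j + 5) {e : V}
    (he : ‖e‖ = 1) {ρ : V → ℝ} (hρ : AEStronglyMeasurable ρ volume) {C : ℝ}
    (hC : ∀ x, |ρ x| ≤ C * ‖x‖⁻¹) {b : ℝ → ℝ} {c : ℝ}
    (hb : ∀ x : V, inner ℝ e x ≠ 0 → ρ x =
      |inner ℝ e x|⁻¹ * b (√(‖x‖ ^ 2 - inner ℝ e x ^ 2) / |inner ℝ e x|))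
    (hB : IntegrableOn (fun s => s ^ (j + 3) * b s - s ^ (j + 2) - c * s ^ j) (Set.Ioi 0))
    (hneg : ∫ s in Set.Ioi (0 : ℝ), (s ^ (j + 3) * b s - s ^ (j + 2) - c * s ^ j) < 0) :
    ∃ δ : ℝ, 0 < δ ∧ δ ≤ 1 ∧ ∫ x, ρ x * testFun δ e x < 0 := by
  set W := (Submodule.span ℝ {e})ᗮ
  have he0 : e ≠ 0 := by rintro rfl; simp at he
  have hW : Module.finrank ℝ W = j + 4 := by
    have h : _ + Module.finrank ℝ W = _ :=
      Submodule.finrank_add_finrank_orthogonal (Submodule.span ℝ {e})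
    rw [finrank_span_singleton he0, hd] at h
    omega
  set κ : ℝ := (j + 4 : ℕ) * volume.real (ball (0 : W) 1) with hκ
  have hκ0 : 0 < κ := by
    have : 0 < volume.real (ball (0 : W) 1) :=
      ENNReal.toReal_pos (measure_ball_pos _ _ one_pos).ne' measure_ball_lt_top.ne
    positivity
  set B : ℝ → ℝ := fun s => s ^ (j + 3) * b s - s ^ (j + 2) - c * s ^ j with hBdef
  let Ψ : ℝ → ℝ → ℝ := fun δ t => ∫ s in Set.Ioi (0 : ℝ), B s * Real.exp (-(δ * t ^ 2 * s ^ 2 / 2))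
  let h : ℝ → ℝ := fun t => (t ^ 4 - 6 * t ^ 2 + 3) * Real.exp (-(t ^ 2 / 2))
  have hbound : ∀ δ t s : ℝ, 0 ≤ δ → ‖B s * Real.exp (-(δ * t ^ 2 * s ^ 2 / 2))‖ ≤ |B s| := by
    intro δ t s hδ
    rw [norm_mul, Real.norm_eq_abs, Real.norm_eq_abs, Real.abs_exp]
    refine mul_le_of_le_one_right (abs_nonneg _) (Real.exp_le_one_iff.2 ?_)
    have : 0 ≤ δ * t ^ 2 * s ^ 2 / 2 := by positivity
    linarith
  have hΨbound : ∀ δ t : ℝ, 0 ≤ δ → |Ψ δ t| ≤ ∫ s in Set.Ioi (0 : ℝ), |B s| := fun δ t hδ =>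
    norm_integral_le_of_norm_le hB.abs (Filter.Eventually.of_forall fun s => hbound δ t s hδ)
  have hΨcont : ∀ δ : ℝ, 0 ≤ δ → Continuous (Ψ δ) := fun δ hδ => by
    refine continuous_of_dominated (bound := fun s => |B s|) (fun t => ?_) (fun t => ?_) hB.abs ?_
    · exact hB.aestronglyMeasurable.mul (by fun_prop)
    · exact Filter.Eventually.of_forall fun s => hbound δ t s hδ
    · exact Filter.Eventually.of_forall fun s => by fun_prop
  have hhΨ : ∀ δ : ℝ, 0 ≤ δ → Integrable (fun t => h t * |t| ^ (j + 3) * Ψ δ t) := fun δ hδ =>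
    (integrable_quartic_gauss_mul_abs_pow (j + 3)).mul_bdd
      (c := ∫ s in Set.Ioi (0 : ℝ), |B s|) (hΨcont δ hδ).aestronglyMeasurable
      (Filter.Eventually.of_forall fun t => hΨbound δ t hδ)
  have hmain : ∀ δ : ℝ, 0 < δ → δ ≤ 1 → ∫ x, ρ x * testFun δ e x =
      κ * ∫ t, h t * |t| ^ (j + 3) * Ψ δ t := by
    intro δ hδ hδ1
    have hint := integrable_mul_testFun (k := j + 3) hd hδ hδ1 he.le hρ hC
    rw [integral_lineProd he, integral_prod _
      (by exact ((measurePreserving_lineProd he).integrable_comp_emb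
        (measurableEmbedding_lineProd he)).2 hint)]
    set A := δ ^ (-((j : ℝ) + 3) / 2) * gaussMoment (j + 2)
    set D := c * δ ^ (-((j : ℝ) + 1) / 2) * gaussMoment j
    -- These two integrals are zero, so the coefficients A and D, which may be unbounded as δ → 0,
    -- drop out.
    have h0 := integral_quartic_gauss_mul_abs_pow 0
    have h2 := integral_quartic_gauss_mul_abs_pow 2
    have i0 := integrable_quartic_gauss_mul_abs_pow 0
    have i2 := integrable_quartic_gauss_mul_abs_pow 2
    have hae : ∀ᵐ t : ℝ, ∫ y : W, ρ (t • e + (y : V)) * testFun δ e (t • e + (y : V)) =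
        κ * (h t * |t| ^ (j + 3) * Ψ δ t + (A * (h t * |t| ^ 0) + D * (h t * |t| ^ 2))) := by
      filter_upwards [Measure.ae_ne volume (0 : ℝ)] with t ht
      have hpt : ∀ y : W, ρ (t • e + (y : V)) * testFun δ e (t • e + (y : V)) =
          h t * (|t|⁻¹ * b (‖y‖ / |t|) * Real.exp (-(δ * ‖y‖ ^ 2 / 2))) := by
        intro y
        have h1 := inner_lineProd he t y
        have h2 := norm_sq_lineProd he t y
        rw [hb _ (by rwa [h1]), testFun, spheroidForm, h1, h2, add_sub_cancel_left,
          Real.sqrt_sq (norm_nonneg _)]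
        simp only [h]
        rw [show -((t ^ 2 + δ * ‖y‖ ^ 2) / 2) = -(t ^ 2 / 2) + -(δ * ‖y‖ ^ 2 / 2) by ring,
          Real.exp_add]
        ring
      simp only [hpt]
      rw [integral_const_mul, integral_radial_mul_gauss hW hB hδ ht, sq_abs]
      simp only [Ψ, A, D, κ, hBdef]
      ring
    rw [integral_congr_ae hae, integral_const_mul,
      integral_add (hhΨ δ hδ.le) (by exact (i0.const_mul A).add (i2.const_mul D)),
      integral_add (by exact i0.const_mul A) (by exact i2.const_mul D), integral_const_mul,
      integral_const_mul]
    simp only [h]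
    rw [h0, h2]
    simp
  have hlim : Filter.Tendsto (fun δ => ∫ t, h t * |t| ^ (j + 3) * Ψ δ t) (nhdsWithin 0 (Set.Ioi 0))
      (nhds (∫ t, h t * |t| ^ (j + 3) * ∫ s in Set.Ioi (0 : ℝ), B s)) := by
    refine tendsto_integral_filter_of_dominated_convergence
      (fun t => ‖h t * |t| ^ (j + 3)‖ * ∫ s in Set.Ioi (0 : ℝ), |B s|) ?_ ?_ ?_ ?_
    · filter_upwards [self_mem_nhdsWithin] with δ hδ
      exact (hhΨ δ (le_of_lt hδ)).aestronglyMeasurable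
    · filter_upwards [self_mem_nhdsWithin] with δ hδ
      refine Filter.Eventually.of_forall fun t => ?_
      rw [norm_mul]
      exact mul_le_mul_of_nonneg_left (hΨbound δ t (le_of_lt hδ)) (norm_nonneg _)
    · exact (integrable_quartic_gauss_mul_abs_pow (j + 3)).norm.mul_const _
    · refine Filter.Eventually.of_forall fun t => Filter.Tendsto.const_mul _ ?_
      refine tendsto_integral_filter_of_dominated_convergence (fun s => |B s|) ?_ ?_ hB.abs ?_
      · exact Filter.Eventually.of_forall fun δ => hB.aestronglyMeasurable.mul (by fun_prop)
      · filter_upwards [self_mem_nhdsWithin] with δ hδ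
        exact Filter.Eventually.of_forall fun s => hbound δ t s (le_of_lt hδ)
      · refine Filter.Eventually.of_forall fun s => ?_
        have : Continuous (fun δ : ℝ => B s * Real.exp (-(δ * t ^ 2 * s ^ 2 / 2))) := by fun_prop
        have := (this.tendsto 0).mono_left (nhdsWithin_le_nhds (s := Set.Ioi 0))
        simpa using this
  have hval : ∫ t, h t * |t| ^ (j + 3) * ∫ s in Set.Ioi (0 : ℝ), B s < 0 := by
    rw [integral_mul_const]
    refine mul_neg_of_pos_of_neg ?_ hneg
    have := integral_quartic_gauss_mul_abs_pow (j + 3)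
    simp only [h]
    rw [this]
    have := gaussMoment_pos (j + 3)
    have h1 : (0 : ℝ) < ((j + 3 : ℕ) : ℝ) - 2 := by
      push_cast
      linarith [(j.cast_nonneg : (0 : ℝ) ≤ j)]
    positivity
  have hev := (hlim.eventually_lt_const hval).and
    ((eventually_nhdsWithin_of_forall (s := Set.Ioi (0 : ℝ)) fun δ hδ => hδ).and
      (nhdsWithin_le_nhds (Iic_mem_nhds (zero_lt_one (α := ℝ)))))
  obtain ⟨δ, h1, h2, h3⟩ := hev.exists
  exact ⟨δ, h2, h3, by rw [hmain δ h2 h3]; exact mul_neg_of_pos_of_neg hκ0 h1⟩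

end Limit

/-! ### The body of revolution: convexity and radial function. -/

section RevolutionBody

/-- The unit vector along the axis of revolution. -/
noncomputable def axis (n : ℕ) : E (n + 1) := EuclideanSpace.single (Fin.last n) 1

theorem norm_axis (n : ℕ) : ‖axis n‖ = 1 := by simp [axis]

theorem inner_axis {n : ℕ} (x : E (n + 1)) : inner ℝ (axis n) x = x (Fin.last n) := by
  simp [axis, EuclideanSpace.inner_single_left]

theorem norm_sq_eq_sum_castSucc {n : ℕ} (x : E (n + 1)) :
    ‖x‖ ^ 2 = ∑ i : Fin n, x i.castSucc ^ 2 + x (Fin.last n) ^ 2 := by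
  rw [EuclideanSpace.real_norm_sq_eq, Fin.sum_univ_castSucc]

theorem mem_revolutionBody_iff {ε : ℝ} {x : E 5} : x ∈ revolutionBody ε ↔
    (∑ i : Fin 4, x i.castSucc ^ 2) ^ 2 + x (Fin.last 4) ^ 2 + ε * x (Fin.last 4) ^ 4 ≤ 1 := by
  set r := ∑ i : Fin 4, x i.castSucc ^ 2 with hr
  have hr0 : 0 ≤ r := Finset.sum_nonneg fun i _ => sq_nonneg _
  set p := 1 - x (Fin.last 4) ^ 2 - ε * x (Fin.last 4) ^ 4 with hp
  have key : 0 ≤ p → (√r ≤ p ^ (1 / 4 : ℝ) ↔ r ^ 2 ≤ p) := by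
    intro hp0
    have h4 : (p ^ (1 / 4 : ℝ)) ^ 4 = p := by
      rw [← Real.rpow_natCast, ← Real.rpow_mul hp0]; norm_num
    have h4' : √r ^ 4 = r ^ 2 := by
      rw [show (4 : ℕ) = 2 * 2 from rfl, pow_mul, Real.sq_sqrt hr0]
    rw [← pow_le_pow_iff_left₀ (Real.sqrt_nonneg r) (Real.rpow_nonneg hp0 _) four_ne_zero, h4, h4']
  have : x ∈ revolutionBody ε ↔ 0 ≤ p ∧ √r ≤ p ^ (1 / 4 : ℝ) := Iff.rfl
  rw [this]
  constructor
  · rintro ⟨h1, h2⟩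
    have := (key h1).1 h2
    linarith
  · intro h
    have h1 : 0 ≤ p := by linarith [sq_nonneg r]
    exact ⟨h1, (key h1).2 (by linarith)⟩

theorem isOriginSymmetric_revolutionBody (ε : ℝ) : IsOriginSymmetric (revolutionBody ε) := by
  intro x hx
  rw [mem_revolutionBody_iff] at hx ⊢
  simpa [Even.neg_pow (by decide : Even 4)] using hx

/-- The section radius is a concave function of the height: the fourth root is concave and
increasing, and 1 - z² - εz⁴ is concave. -/
theorem convex_revolutionBody {ε : ℝ} (hε : 0 < ε) : Convex ℝ (revolutionBody ε) := by
  have hp : ConcaveOn ℝ Set.univ (fun z : ℝ => 1 - z ^ 2 - ε * z ^ 4) :=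
    ((concaveOn_const (1 : ℝ) convex_univ).sub (Even.convexOn_pow (by decide : Even 2))).sub
      ((Even.convexOn_pow (by decide : Even 4)).smul hε.le)
  have hq := Real.concaveOn_rpow (p := 1 / 4) (by norm_num) (by norm_num)
  have hnorm : ∀ x : E 5, √(∑ i : Fin 4, x i.castSucc ^ 2) =
      ‖(WithLp.toLp 2 (fun i : Fin 4 => x i.castSucc) : E 4)‖ := fun x => by
    rw [EuclideanSpace.norm_eq]
    simp
  rintro x ⟨hx1, hx2⟩ y ⟨hy1, hy2⟩ a b ha hb hab
  have h1 := hp.2 (Set.mem_univ (x (Fin.last 4))) (Set.mem_univ (y (Fin.last 4))) ha hb hab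
  have h2 := hq.2 (Set.mem_Ici.2 hx1) (Set.mem_Ici.2 hy1) ha hb hab
  have hxy : (a • x + b • y) (Fin.last 4) = a * x (Fin.last 4) + b * y (Fin.last 4) := by simp
  simp only [smul_eq_mul] at h1 h2
  rw [hnorm] at hx2 hy2
  refine ⟨?_, ?_⟩
  · rw [hxy]
    refine le_trans ?_ h1
    positivity
  · rw [hxy, hnorm]
    have h3 : (WithLp.toLp 2 (fun i : Fin 4 => (a • x + b • y) i.castSucc) : E 4) =
        a • (WithLp.toLp 2 (fun i : Fin 4 => x i.castSucc) : E 4) +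
          b • (WithLp.toLp 2 (fun i : Fin 4 => y i.castSucc) : E 4) := by
      ext i; simp
    rw [h3]
    calc _ ≤ a * ‖(WithLp.toLp 2 (fun i : Fin 4 => x i.castSucc) : E 4)‖ +
          b * ‖(WithLp.toLp 2 (fun i : Fin 4 => y i.castSucc) : E 4)‖ := by
          refine (norm_add_le _ _).trans_eq ?_
          rw [norm_smul, norm_smul, Real.norm_of_nonneg ha, Real.norm_of_nonneg hb]
      _ ≤ _ := add_le_add (mul_le_mul_of_nonneg_left hx2 ha) (mul_le_mul_of_nonneg_left hy2 hb)
      _ ≤ _ := h2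
      _ ≤ _ := Real.rpow_le_rpow (by positivity) h1 (by norm_num)

theorem isConvexBody_revolutionBody {ε : ℝ} (hε : 0 < ε) : IsConvexBody (revolutionBody ε) := by
  have hset : revolutionBody ε = {x : E 5 | (∑ i : Fin 4, x i.castSucc ^ 2) ^ 2 +
      x (Fin.last 4) ^ 2 + ε * x (Fin.last 4) ^ 4 ≤ 1} := by
    ext x; exact mem_revolutionBody_iff
  have hcont : Continuous fun x : E 5 => (∑ i : Fin 4, x i.castSucc ^ 2) ^ 2 +
      x (Fin.last 4) ^ 2 + ε * x (Fin.last 4) ^ 4 := by fun_prop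
  refine ⟨convex_revolutionBody hε, ?_, ?_⟩
  · refine isCompact_of_isClosed_isBounded ?_ ?_
    · rw [hset]
      exact isClosed_le hcont continuous_const
    · refine isBounded_iff_forall_norm_le.2 ⟨2, fun x hx => ?_⟩
      rw [mem_revolutionBody_iff] at hx
      have h := norm_sq_eq_sum_castSucc x
      have hr0 : 0 ≤ ∑ i : Fin 4, x i.castSucc ^ 2 := Finset.sum_nonneg fun i _ => sq_nonneg _
      have h4 : 0 ≤ ε * x (Fin.last 4) ^ 4 := by positivity
      refine abs_le_of_sq_le_sq' ?_ zero_le_two |>.2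
      nlinarith [sq_nonneg (x (Fin.last 4))]
  · refine ⟨0, mem_interior.2 ⟨{x : E 5 | (∑ i : Fin 4, x i.castSucc ^ 2) ^ 2 +
      x (Fin.last 4) ^ 2 + ε * x (Fin.last 4) ^ 4 < 1}, ?_, isOpen_lt hcont continuous_const, ?_⟩⟩
    · rw [hset]
      exact Set.ofPred_subset_ofPred.2 fun x hx => le_of_lt hx
    · simp

/-- The square of the gauge of `revolutionBody ε`, as a function of the square `q` of the distance
to the axis and of the height `t`. -/
noncomputable def revolutionGaugeSq (ε q t : ℝ) : ℝ :=
  (t ^ 2 + √(t ^ 4 + 4 * (q ^ 2 + ε * t ^ 4))) / 2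

/-- With x/√l on the boundary, (q/l)² + t²/l + εt⁴/l² = 1; clearing denominators gives this
quadratic equation for l. -/
theorem revolutionGaugeSq_sq {ε : ℝ} (hε : 0 < ε) (q t : ℝ) :
    revolutionGaugeSq ε q t ^ 2 = t ^ 2 * revolutionGaugeSq ε q t + (q ^ 2 + ε * t ^ 4) := by
  have := Real.sq_sqrt (show 0 ≤ t ^ 4 + 4 * (q ^ 2 + ε * t ^ 4) by positivity)
  rw [revolutionGaugeSq]
  linear_combination this / 4

theorem le_revolutionGaugeSq {ε : ℝ} (hε : 0 < ε) {q : ℝ} (hq : 0 ≤ q) (t : ℝ) :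
    (q + t ^ 2) / 2 ≤ revolutionGaugeSq ε q t := by
  have : 2 * q ≤ √(t ^ 4 + 4 * (q ^ 2 + ε * t ^ 4)) := by
    refine Real.le_sqrt_of_sq_le ?_
    have : 0 ≤ ε * t ^ 4 := by positivity
    nlinarith [sq_nonneg (t ^ 2)]
  rw [revolutionGaugeSq]
  linarith

/-- The radial function of `revolutionBody ε`. -/
noncomputable def revolutionRadial (ε : ℝ) (x : E 5) : ℝ :=
  (√(revolutionGaugeSq ε (∑ i : Fin 4, x i.castSucc ^ 2) (x (Fin.last 4))))⁻¹

theorem radialFunction_revolutionBody {ε : ℝ} (hε : 0 < ε) {x : E 5} (hx : x ≠ 0) :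
    radialFunction (revolutionBody ε) x = revolutionRadial ε x := by
  set q := ∑ i : Fin 4, x i.castSucc ^ 2 with hq
  have hq0 : 0 ≤ q := Finset.sum_nonneg fun i _ => sq_nonneg _
  set t := x (Fin.last 4) with ht
  have hnx : ‖x‖ ^ 2 = q + t ^ 2 := norm_sq_eq_sum_castSucc x
  have hx0 : 0 < ‖x‖ := norm_pos_iff.2 hx
  set l := revolutionGaugeSq ε q t with hl
  have hl0 : 0 < l := by
    have := le_revolutionGaugeSq hε hq0 t
    rw [← hnx] at this
    have : 0 < ‖x‖ ^ 2 / 2 := by positivity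
    linarith
  have hl2 := revolutionGaugeSq_sq hε q t
  rw [← hl] at hl2
  have hD : 0 ≤ q ^ 2 + ε * t ^ 4 := by positivity
  have hmem : ∀ a : ℝ, 0 < a → (a • x ∈ revolutionBody ε ↔ a ≤ (√l)⁻¹) := by
    intro a ha
    rw [mem_revolutionBody_iff]
    have h1 : (∑ i : Fin 4, (a • x) i.castSucc ^ 2) = a ^ 2 * q := by
      simp [hq, Finset.mul_sum, mul_pow]
    have h2 : (a • x) (Fin.last 4) = a * t := by simp [ht]
    rw [h1, h2, le_inv_comm₀ ha (Real.sqrt_pos.2 hl0), Real.sqrt_le_left (by positivity)]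
    have h3 : (a ^ 2 * q) ^ 2 + (a * t) ^ 2 + ε * (a * t) ^ 4 =
        (a ^ 2) ^ 2 * (l ^ 2 - t ^ 2 * l) + a ^ 2 * t ^ 2 := by rw [hl2]; ring
    have ha2 : 0 < a ^ 2 := by positivity
    have htl : t ^ 2 ≤ l := by nlinarith
    have h4 : (l ≤ a⁻¹ ^ 2) ↔ a ^ 2 * l ≤ 1 := by
      rw [inv_pow, ← one_div, le_div_iff₀ ha2, mul_comm]
    rw [h3, h4]
    -- The membership polynomial factors through the root l of the quadratic, and the other factor
    -- is positive because t² ≤ l.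
    have h5 : (a ^ 2) ^ 2 * (l ^ 2 - t ^ 2 * l) + a ^ 2 * t ^ 2 - 1 =
        (a ^ 2 * l - 1) * (a ^ 2 * (l - t ^ 2) + 1) := by ring
    have h6 : 0 < a ^ 2 * (l - t ^ 2) + 1 := by
      have : 0 ≤ a ^ 2 * (l - t ^ 2) := mul_nonneg ha2.le (by linarith)
      linarith
    rw [← sub_nonpos, h5, ← sub_nonpos (a := a ^ 2 * l)]
    exact ⟨fun h => nonpos_of_mul_nonpos_left h h6, fun h => mul_nonpos_of_nonpos_of_nonneg h h6.le⟩
  have hset : {a : ℝ | 0 < a ∧ a • x ∈ revolutionBody ε} = Set.Ioc 0 (√l)⁻¹ := by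
    ext a
    exact ⟨fun h => ⟨h.1, (hmem a h.1).1 h.2⟩, fun h => ⟨h.1, (hmem a h.1).2 h.2⟩⟩
  rw [radialFunction, hset, csSup_Ioc (inv_pos.2 (Real.sqrt_pos.2 hl0))]
  rfl

theorem measurable_revolutionRadial (ε : ℝ) : Measurable (revolutionRadial ε) := by
  unfold revolutionRadial revolutionGaugeSq
  fun_prop

theorem abs_revolutionRadial_le {ε : ℝ} (hε : 0 < ε) (x : E 5) :
    |revolutionRadial ε x| ≤ 2 * ‖x‖⁻¹ := by
  have hq0 : 0 ≤ ∑ i : Fin 4, x i.castSucc ^ 2 := Finset.sum_nonneg fun i _ => sq_nonneg _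
  have h := le_revolutionGaugeSq hε hq0 (x (Fin.last 4))
  rw [← norm_sq_eq_sum_castSucc] at h
  rw [revolutionRadial, abs_of_nonneg (inv_nonneg.2 (Real.sqrt_nonneg _))]
  -- At the origin both sides are 0, by the convention 0⁻¹ = 0.
  rcases eq_or_ne x 0 with rfl | hx
  · simp [revolutionGaugeSq]
  have hx0 : 0 < ‖x‖ := norm_pos_iff.2 hx
  have h1 : ‖x‖ / 2 ≤ √(revolutionGaugeSq ε (∑ i : Fin 4, x i.castSucc ^ 2) (x (Fin.last 4))) := by
    refine Real.le_sqrt_of_sq_le ?_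
    nlinarith
  calc _ ≤ (‖x‖ / 2)⁻¹ := inv_anti₀ (by positivity) h1
    _ = _ := by field_simp

theorem revolutionGaugeSq_mul (ε q t a : ℝ) :
    revolutionGaugeSq ε (a ^ 2 * q) (a * t) = a ^ 2 * revolutionGaugeSq ε q t := by
  have : (a * t) ^ 4 + 4 * ((a ^ 2 * q) ^ 2 + ε * (a * t) ^ 4) =
      (a ^ 2) ^ 2 * (t ^ 4 + 4 * (q ^ 2 + ε * t ^ 4)) := by ring
  rw [revolutionGaugeSq, revolutionGaugeSq, this, Real.sqrt_mul (by positivity),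
    Real.sqrt_sq (by positivity)]
  ring

theorem revolutionRadial_smul (ε : ℝ) (r : ℝ) (x : E 5) (hr : 0 < r) :
    revolutionRadial ε (r • x) = r⁻¹ * revolutionRadial ε x := by
  have h1 : (∑ i : Fin 4, (r • x) i.castSucc ^ 2) = r ^ 2 * ∑ i : Fin 4, x i.castSucc ^ 2 := by
    simp [Finset.mul_sum, mul_pow]
  have h2 : (r • x) (Fin.last 4) = r * x (Fin.last 4) := by simp
  rw [revolutionRadial, h1, h2, revolutionGaugeSq_mul, Real.sqrt_mul (by positivity),
    Real.sqrt_sq hr.le, mul_inv]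
  rfl

theorem revolutionRadial_eq (ε : ℝ) {x : E 5} (hx : inner ℝ (axis 4) x ≠ 0) :
    revolutionRadial ε x = |inner ℝ (axis 4) x|⁻¹ * (√(revolutionGaugeSq ε
      ((√(‖x‖ ^ 2 - inner ℝ (axis 4) x ^ 2) / |inner ℝ (axis 4) x|) ^ 2) 1))⁻¹ := by
  rw [inner_axis] at hx ⊢
  have ht : 0 < |x (Fin.last 4)| := abs_pos.2 hx
  have hq0 : 0 ≤ ∑ i : Fin 4, x i.castSucc ^ 2 := Finset.sum_nonneg fun i _ => sq_nonneg _
  rw [norm_sq_eq_sum_castSucc, add_sub_cancel_right, div_pow, Real.sq_sqrt hq0]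
  have h := revolutionGaugeSq_mul ε ((∑ i : Fin 4, x i.castSucc ^ 2) / |x (Fin.last 4)| ^ 2) 1
    |x (Fin.last 4)|
  rw [mul_div_cancel₀ _ (by positivity), mul_one] at h
  have h' : revolutionGaugeSq ε (∑ i : Fin 4, x i.castSucc ^ 2) |x (Fin.last 4)| =
      revolutionGaugeSq ε (∑ i : Fin 4, x i.castSucc ^ 2) (x (Fin.last 4)) := by
    have h4 : ∀ t : ℝ, |t| ^ 4 = t ^ 4 := fun t => by
      rw [show (4 : ℕ) = 2 * 2 from rfl, pow_mul, sq_abs, pow_mul]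
    simp only [revolutionGaugeSq, sq_abs, h4]
  rw [revolutionRadial, ← h', h, Real.sqrt_mul (by positivity), Real.sqrt_sq ht.le, mul_inv]

end RevolutionBody

/-! ### The explicit one-dimensional integral for the body of revolution. -/

section RevolutionIntegral

variable {ε : ℝ}

theorem revolutionGaugeSq_one_sub (hε : 0 < ε) (q : ℝ) :
    (revolutionGaugeSq ε q 1 - 1 / 2) ^ 2 = q ^ 2 + ε + 1 / 4 := by
  have := revolutionGaugeSq_sq hε q 1
  linear_combination this

theorem one_le_revolutionGaugeSq (hε : 0 < ε) (q : ℝ) : 1 ≤ revolutionGaugeSq ε q 1 := by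
  have : 1 ≤ √((1 : ℝ) ^ 4 + 4 * (q ^ 2 + ε * 1 ^ 4)) := by
    refine Real.le_sqrt_of_sq_le ?_
    nlinarith [sq_nonneg q]
  rw [revolutionGaugeSq, le_div_iff₀ two_pos, one_pow 2]
  linarith only [this]

theorem revolutionGaugeSq_bounds (hε : 0 < ε) (hε1 : ε < 1) {s : ℝ} (hs : 0 < s) :
    s ^ 2 + 1 / 2 ≤ revolutionGaugeSq ε (s ^ 2) 1 ∧
      revolutionGaugeSq ε (s ^ 2) 1 ≤ s ^ 2 + 1 / 2 + 1 / s ^ 2 := by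
  have h := revolutionGaugeSq_one_sub hε (s ^ 2)
  have h1 := one_le_revolutionGaugeSq hε (s ^ 2)
  set L := revolutionGaugeSq ε (s ^ 2) 1
  have hs2 : 0 < s ^ 2 := by positivity
  constructor
  · nlinarith
  · have h2 : (s ^ 2 + 1 / s ^ 2) ^ 2 = (s ^ 2) ^ 2 + 2 + (1 / s ^ 2) ^ 2 := by field_simp; ring
    have h3 : L - 1 / 2 ≤ s ^ 2 + 1 / s ^ 2 := by
      refine abs_le_of_sq_le_sq' ?_ (by positivity) |>.2
      rw [h, h2]
      nlinarith [sq_nonneg (1 / s ^ 2)]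
    linarith

/-- Since L = s² + 1/2 + O(s⁻²), s³/√L = s² - 1/4 + O(s⁻²). This fixes the correction c = -1/4 and
gives integrability at infinity. -/
theorem abs_revolution_integrand_le (hε : 0 < ε) (hε1 : ε < 1) {s : ℝ} (hs : 0 < s) :
    |s ^ 3 * (√(revolutionGaugeSq ε (s ^ 2) 1))⁻¹ - s ^ 2 + 1 / 4| ≤ 4 * (1 + s ^ 2)⁻¹ := by
  obtain ⟨hb1, hb2⟩ := revolutionGaugeSq_bounds hε hε1 hs
  have h1 := one_le_revolutionGaugeSq hε (s ^ 2)
  set L := revolutionGaugeSq ε (s ^ 2) 1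
  have hl1 : 1 ≤ √L := Real.one_le_sqrt.2 h1
  have hl2 : √L ^ 2 = L := Real.sq_sqrt (by linarith)
  set l := √L
  have hs2 : 0 < s ^ 2 := by positivity
  rcases le_or_gt s 1 with hs1 | hs1
  · have h4 : s ^ 2 ≤ 1 := by nlinarith
    have h3 : s ^ 3 ≤ 1 := pow_le_one₀ hs.le hs1
    have h5 : 0 ≤ s ^ 3 * l⁻¹ := by positivity
    have h6 : s ^ 3 * l⁻¹ ≤ 1 := mul_le_one₀ h3 (by positivity) (inv_le_one_of_one_le₀ hl1)
    have h7 : (2 : ℝ)⁻¹ ≤ (1 + s ^ 2)⁻¹ := inv_anti₀ (by positivity) (by linarith)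
    rw [abs_le]
    constructor <;> linarith
  · have hs12 : 1 < s ^ 2 := by nlinarith
    have hsl : s ≤ l := by
      refine abs_le_of_sq_le_sq' ?_ (by positivity) |>.2
      linarith
    have hθ : (L - s ^ 2 - 1 / 2) * s ^ 2 ≤ 1 := by
      have : L - s ^ 2 - 1 / 2 ≤ 1 / s ^ 2 := by linarith
      rwa [le_div_iff₀ hs2] at this
    have hθ0 : 0 ≤ L - s ^ 2 - 1 / 2 := by linarith
    -- Multiplication by the conjugate exposes the cancellation of the leading powers of s; what
    -- remains is of order s².
    have hid : (s ^ 3 - (s ^ 2 - 1 / 4) * l) * (s ^ 3 + (s ^ 2 - 1 / 4) * l) =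
        3 * s ^ 2 / 16 - 1 / 32 - (L - s ^ 2 - 1 / 2) * (s ^ 2 - 1 / 4) ^ 2 := by
      linear_combination (-(s ^ 2 - 1 / 4) ^ 2) * hl2
    have hsq : (s ^ 2 - 1 / 4) ^ 2 ≤ s ^ 2 * s ^ 2 := by nlinarith
    have hθ2 : (L - s ^ 2 - 1 / 2) * (s ^ 2 - 1 / 4) ^ 2 ≤ s ^ 2 := by
      calc _ ≤ (L - s ^ 2 - 1 / 2) * (s ^ 2 * s ^ 2) := mul_le_mul_of_nonneg_left hsq hθ0
        _ = ((L - s ^ 2 - 1 / 2) * s ^ 2) * s ^ 2 := by ring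
        _ ≤ 1 * s ^ 2 := mul_le_mul_of_nonneg_right hθ hs2.le
        _ = s ^ 2 := one_mul _
    have hθ3 : 0 ≤ (L - s ^ 2 - 1 / 2) * (s ^ 2 - 1 / 4) ^ 2 := by positivity
    have hden : s ^ 3 ≤ s ^ 3 + (s ^ 2 - 1 / 4) * l := by
      have : 0 ≤ (s ^ 2 - 1 / 4) * l := mul_nonneg (by linarith) (by linarith)
      linarith
    have hnum : |(s ^ 3 - (s ^ 2 - 1 / 4) * l) * (s ^ 3 + (s ^ 2 - 1 / 4) * l)| ≤ 2 * s ^ 2 := by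
      rw [hid, abs_le]
      constructor <;> linarith
    rw [abs_mul, abs_of_pos (a := s ^ 3 + _) (by linarith [pow_pos hs 3])] at hnum
    have hB : s ^ 3 * l⁻¹ - s ^ 2 + 1 / 4 = (s ^ 3 - (s ^ 2 - 1 / 4) * l) / l := by
      field_simp
      ring
    rw [hB, abs_div, abs_of_pos (by linarith : 0 < l), div_le_iff₀ (by linarith)]
    have hA : |s ^ 3 - (s ^ 2 - 1 / 4) * l| * s ≤ 2 := by
      have := (mul_le_mul_of_nonneg_left hden (abs_nonneg (s ^ 3 - (s ^ 2 - 1 / 4) * l))).trans hnum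
      have h' : |s ^ 3 - (s ^ 2 - 1 / 4) * l| * s * s ^ 2 ≤ 2 * s ^ 2 := by linarith
      exact le_of_mul_le_mul_right h' hs2
    have hA' : |s ^ 3 - (s ^ 2 - 1 / 4) * l| ≤ 2 / s := by rwa [le_div_iff₀ hs]
    refine hA'.trans ?_
    rw [div_le_iff₀ hs]
    have : 4 * (1 + s ^ 2)⁻¹ * l * s = 4 * (l * s) / (1 + s ^ 2) := by field_simp
    rw [this, le_div_iff₀ (by positivity)]
    nlinarith

theorem integrableOn_revolution_integrand (hε : 0 < ε) (hε1 : ε < 1) :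
    IntegrableOn (fun s => s ^ 3 * (√(revolutionGaugeSq ε (s ^ 2) 1))⁻¹ - s ^ 2 + 1 / 4)
      (Set.Ioi 0) := by
  refine Integrable.mono' (integrable_inv_one_add_sq.const_mul 4).integrableOn ?_ ?_
  · refine Measurable.aestronglyMeasurable ?_
    unfold revolutionGaugeSq
    fun_prop
  · exact (ae_restrict_iff' measurableSet_Ioi).2
      (Filter.Eventually.of_forall fun s hs => abs_revolution_integrand_le hε hε1 hs)

/-- Put l = √L. Differentiating L² - L = s⁴ + ε gives (2L - 1) L' = 4s³, hence s³/l ds = (l² - 1/2)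
dl, with primitive l³/3 - l/2. -/
theorem hasDerivAt_revolution_primitive (hε : 0 < ε) (s : ℝ) :
    HasDerivAt (fun s => √(revolutionGaugeSq ε (s ^ 2) 1) ^ 3 / 3
        - √(revolutionGaugeSq ε (s ^ 2) 1) / 2 - s ^ 3 / 3 + s / 4)
      (s ^ 3 * (√(revolutionGaugeSq ε (s ^ 2) 1))⁻¹ - s ^ 2 + 1 / 4) s := by
  have h1 := one_le_revolutionGaugeSq hε (s ^ 2)
  have hL : HasDerivAt (fun s => revolutionGaugeSq ε (s ^ 2) 1)
      (4 * s ^ 3 / √(1 ^ 4 + 4 * ((s ^ 2) ^ 2 + ε * 1 ^ 4))) s := by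
    have hG : HasDerivAt (fun s : ℝ => (1 : ℝ) ^ 4 + 4 * ((s ^ 2) ^ 2 + ε * 1 ^ 4))
        (16 * s ^ 3) s := by
      have := ((((hasDerivAt_pow 2 s).pow 2).add_const (ε * 1 ^ 4)).const_mul 4).const_add
        ((1 : ℝ) ^ 4)
      refine this.congr_deriv ?_
      simp
      ring
    have := ((hG.sqrt (by positivity)).const_add ((1 : ℝ) ^ 2)).div_const 2
    refine this.congr_deriv ?_
    field_simp
    ring
  have hsq : √((1 : ℝ) ^ 4 + 4 * ((s ^ 2) ^ 2 + ε * 1 ^ 4)) =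
      2 * revolutionGaugeSq ε (s ^ 2) 1 - 1 := by
    rw [revolutionGaugeSq]; ring
  rw [hsq] at hL
  have hl := hL.sqrt (by linarith)
  have := ((((hl.pow 3).div_const 3).sub (hl.div_const 2)).sub
    ((hasDerivAt_pow 3 s).div_const 3)).add ((hasDerivAt_id s).div_const 4)
  refine this.congr_deriv ?_
  have hl2 := Real.sq_sqrt (show 0 ≤ revolutionGaugeSq ε (s ^ 2) 1 by linarith)
  have hl0 : 0 < √(revolutionGaugeSq ε (s ^ 2) 1) := Real.sqrt_pos.2 (by linarith)
  have h2 : 2 * revolutionGaugeSq ε (s ^ 2) 1 - 1 ≠ 0 := by linarith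
  simp only [Nat.cast_ofNat, Nat.add_one_sub_one]
  generalize √(revolutionGaugeSq ε (s ^ 2) 1) = l at *
  rw [← hl2] at h2 ⊢
  obtain ⟨d, hd⟩ : ∃ d, d = 2 * l ^ 2 - 1 := ⟨_, rfl⟩
  rw [← hd] at h2 ⊢
  field_simp
  rw [hd]
  ring

/-- The primitive has no constant term at infinity, so the integral is minus its value at 0. -/
theorem tendsto_revolution_primitive (hε : 0 < ε) (hε1 : ε < 1) :
    Filter.Tendsto (fun s => √(revolutionGaugeSq ε (s ^ 2) 1) ^ 3 / 3
        - √(revolutionGaugeSq ε (s ^ 2) 1) / 2 - s ^ 3 / 3 + s / 4) Filter.atTop (nhds 0) := by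
  have h0 : Filter.Tendsto (fun s : ℝ => 20 * s⁻¹) Filter.atTop (nhds 0) := by
    simpa using tendsto_inv_atTop_zero.const_mul (20 : ℝ)
  refine squeeze_zero_norm' ?_ h0
  filter_upwards [Filter.eventually_ge_atTop 1] with s hs1
  have hs : 0 < s := by linarith
  obtain ⟨hb1, hb2⟩ := revolutionGaugeSq_bounds hε hε1 hs
  set L := revolutionGaugeSq ε (s ^ 2) 1
  have hs2 : 1 ≤ s ^ 2 := by nlinarith
  have hl2 : √L ^ 2 = L := Real.sq_sqrt (by linarith)
  have hl0 : 0 ≤ √L := Real.sqrt_nonneg L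
  set l := √L
  have hsl : s ≤ l := by
    refine abs_le_of_sq_le_sq' ?_ (by positivity) |>.2
    linarith
  have hinv : 1 / s ^ 2 ≤ 1 := by rw [div_le_one (by positivity)]; exact hs2
  have hl3 : l ≤ 2 * s := by
    refine abs_le_of_sq_le_sq' ?_ (by positivity) |>.2
    nlinarith
  -- The start of the expansion of √(s² + 1/2). It approximates l within s⁻³, enough to withstand
  -- the cubic term, and the primitive evaluated at m is an explicit O(1/s).
  set m := s + 1 / (4 * s) with hm
  have hm2 : m ^ 2 = s ^ 2 + 1 / 2 + 1 / 16 * (1 / s ^ 2) := by rw [hm]; field_simp; ring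
  have hsm : s ≤ m := by rw [hm]; linarith [(by positivity : 0 < 1 / (4 * s))]
  have hm3 : m ≤ 2 * s := by
    refine abs_le_of_sq_le_sq' ?_ (by positivity) |>.2
    nlinarith
  have hdiff : |l - m| * s ≤ 1 / s ^ 2 := by
    calc |l - m| * s ≤ |l - m| * (l + m) :=
          mul_le_mul_of_nonneg_left (by linarith) (abs_nonneg _)
      _ = |l ^ 2 - m ^ 2| := by
          rw [sq_sub_sq, abs_mul, abs_of_pos (by linarith : 0 < l + m)]; ring
      _ ≤ 1 / s ^ 2 := by
          have : 0 < 1 / s ^ 2 := by positivity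
          rw [hl2, hm2, abs_le]
          constructor <;> linarith
  have hid : l ^ 3 / 3 - l / 2 - s ^ 3 / 3 + s / 4 =
      (l - m) * ((l ^ 2 + l * m + m ^ 2) / 3 - 1 / 2) + (1 / (192 * s ^ 3) - 1 / (16 * s)) := by
    have : m ^ 3 / 3 - m / 2 - s ^ 3 / 3 + s / 4 = 1 / (192 * s ^ 3) - 1 / (16 * s) := by
      rw [hm]; field_simp; ring
    linear_combination this
  have hfac : |(l ^ 2 + l * m + m ^ 2) / 3 - 1 / 2| ≤ 5 * s ^ 2 := by
    have e1 : l * m ≤ (2 * s) * (2 * s) := mul_le_mul hl3 hm3 (by linarith) (by linarith)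
    have e2 : 0 ≤ l * m := mul_nonneg hl0 (by linarith)
    have e3 : l ^ 2 ≤ (2 * s) ^ 2 := pow_le_pow_left₀ hl0 hl3 2
    have e4 : m ^ 2 ≤ (2 * s) ^ 2 := pow_le_pow_left₀ (by linarith) hm3 2
    rw [abs_le]
    constructor <;> nlinarith [sq_nonneg l, sq_nonneg m]
  have hA : |(l - m) * ((l ^ 2 + l * m + m ^ 2) / 3 - 1 / 2)| ≤ 5 * s⁻¹ := by
    rw [abs_mul]
    have hd' : |l - m| ≤ 1 / s ^ 2 / s := by rwa [le_div_iff₀ hs]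
    calc _ ≤ 1 / s ^ 2 / s * (5 * s ^ 2) := mul_le_mul hd' hfac (abs_nonneg _) (by positivity)
      _ = 5 * s⁻¹ := by field_simp
  have hBb : |1 / (192 * s ^ 3) - 1 / (16 * s)| ≤ s⁻¹ := by
    have e1 : 1 / (192 * s ^ 3) ≤ s⁻¹ := by
      rw [← one_div]
      refine one_div_le_one_div_of_le hs ?_
      nlinarith [pow_pos hs 3]
    have e2 : 1 / (16 * s) ≤ s⁻¹ := by
      rw [← one_div]
      exact one_div_le_one_div_of_le hs (by linarith)
    have e3 : 0 < 1 / (192 * s ^ 3) := by positivity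
    have e4 : 0 < 1 / (16 * s) := by positivity
    rw [abs_le]
    constructor <;> linarith
  rw [hid, Real.norm_eq_abs]
  have : 0 < s⁻¹ := by positivity
  exact (abs_add_le _ _).trans (by linarith)

theorem integral_revolution_integrand_neg (hε : 3 / 4 < ε) (hε1 : ε < 1) :
    ∫ s in Set.Ioi (0 : ℝ), (s ^ 3 * (√(revolutionGaugeSq ε (s ^ 2) 1))⁻¹ - s ^ 2 + 1 / 4) < 0 := by
  have hε0 : 0 < ε := by linarith
  rw [integral_Ioi_of_hasDerivAt_of_tendsto'
    (fun s _ => hasDerivAt_revolution_primitive hε0 s)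
    (integrableOn_revolution_integrand hε0 hε1) (tendsto_revolution_primitive hε0 hε1)]
  have h := revolutionGaugeSq_one_sub hε0 (0 ^ 2)
  have h1 := one_le_revolutionGaugeSq hε0 (0 ^ 2)
  set L := revolutionGaugeSq ε (0 ^ 2) 1
  -- The threshold 3/4 arises here: (L - 1/2)² = ε + 1/4 exceeds 1 when ε > 3/4.
  have hL : 3 / 2 < L := by nlinarith
  have hl2 : √L ^ 2 = L := Real.sq_sqrt (by linarith)
  have hl0 : 0 < √L := Real.sqrt_pos.2 (by linarith)
  have : √L ^ 3 / 3 - √L / 2 = √L * (L - 3 / 2) / 3 := by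
    rw [← hl2]
    ring_nf
    rw [Real.sqrt_sq hl0.le]
    ring
  have h3 : 0 < √L * (L - 3 / 2) := mul_pos hl0 (by linarith)
  linarith

theorem exists_integral_revolutionRadial_neg (hε : 3 / 4 < ε) (hε1 : ε < 1) :
    ∃ δ : ℝ, 0 < δ ∧ δ ≤ 1 ∧ ∫ x, revolutionRadial ε x * testFun δ (axis 4) x < 0 := by
  have hε0 : 0 < ε := by linarith
  have heq : ∀ s : ℝ, s ^ (0 + 3) * (√(revolutionGaugeSq ε (s ^ 2) 1))⁻¹ - s ^ (0 + 2)
      - (-1 / 4) * s ^ 0 = s ^ 3 * (√(revolutionGaugeSq ε (s ^ 2) 1))⁻¹ - s ^ 2 + 1 / 4 := by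
    intro s
    ring
  refine exists_integral_mul_testFun_neg (j := 0) finrank_euclideanSpace_fin (norm_axis 4)
    (measurable_revolutionRadial ε).aestronglyMeasurable (abs_revolutionRadial_le hε0)
    (b := fun s => (√(revolutionGaugeSq ε (s ^ 2) 1))⁻¹) (c := -1 / 4)
    (fun x hx => revolutionRadial_eq ε hx) ?_ ?_
  · simp only [heq]
    exact integrableOn_revolution_integrand hε0 hε1
  · simp only [heq]
    exact integral_revolution_integrand_neg hε hε1

theorem not_isIntersectionBody_revolutionBody (hε : 3 / 4 < ε) (hε1 : ε < 1) :
    ¬ IsIntersectionBody (revolutionBody ε) := by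
  have hε0 : 0 < ε := by linarith
  obtain ⟨δ, hδ0, hδ1, hneg⟩ := exists_integral_revolutionRadial_neg hε hε1
  exact not_isIntersectionBody_of_integral_neg (k := 3)
    (fun x hx => radialFunction_revolutionBody hε0 hx)
    (measurable_revolutionRadial ε).aestronglyMeasurable (abs_revolutionRadial_le hε0)
    (revolutionRadial_smul ε) hδ0 hδ1 (norm_axis 4).le hneg

end RevolutionIntegral

/-! ### Gaussian-type Schwartz functions. -/

section Schwartz

variable {V : Type*} [NormedAddCommGroup V] [InnerProductSpace ℝ V]

/-- The factorial comes from y^N / N! ≤ exp y at y = 1 + r; completing the square bounds the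
remaining exponent r - c r². -/
theorem one_add_pow_mul_exp_neg_le (N : ℕ) {c r : ℝ} (hc : 0 < c) (hr : 0 ≤ r) :
    (1 + r) ^ N * Real.exp (-(c * r ^ 2)) ≤ N.factorial * Real.exp (1 + 1 / (4 * c)) := by
  have h1 : (1 + r) ^ N ≤ N.factorial * Real.exp (1 + r) := by
    have := Real.pow_div_factorial_le_exp (1 + r) (by linarith) N
    rwa [div_le_iff₀ (by positivity), mul_comm] at this
  have h2 : r - c * r ^ 2 ≤ 1 / (4 * c) := by
    rw [le_div_iff₀ (by positivity)]
    nlinarith [sq_nonneg (2 * c * r - 1)]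
  calc _ ≤ N.factorial * Real.exp (1 + r) * Real.exp (-(c * r ^ 2)) := by gcongr
    _ = N.factorial * Real.exp (1 + r + -(c * r ^ 2)) := by rw [Real.exp_add (1 + r)]; ring
    _ ≤ _ := by
      gcongr ?_ * Real.exp ?_
      linarith

/-- The exponential of a function of temperate growth with a negative quadratic upper bound. -/
noncomputable def schwartzExp {f : V → ℝ} (hf : f.HasTemperateGrowth) {c : ℝ} (hc : 0 < c)
    (hb : ∀ x, f x ≤ -(c * ‖x‖ ^ 2)) : 𝓢(V, ℝ) where
  toFun := Real.exp ∘ f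
  smooth' := Real.contDiff_exp.comp hf.1
  decay' k n := by
    obtain ⟨p, C, hC0, hC⟩ := hf.norm_iteratedFDeriv_le_uniform n
    refine ⟨n.factorial * (1 + C) ^ n *
      ((k + p * n).factorial * Real.exp (1 + 1 / (4 * c))), fun x => ?_⟩
    have h1 : ‖iteratedFDeriv ℝ n (Real.exp ∘ f) x‖ ≤
        n.factorial * Real.exp (f x) * ((1 + C) * (1 + ‖x‖) ^ p) ^ n := by
      refine norm_iteratedFDeriv_comp_le (N := n) Real.contDiff_exp
        (hf.1.of_le (by exact_mod_cast le_top)) le_rfl x ?_ ?_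
      · intro i _
        rw [norm_iteratedFDeriv_eq_norm_iteratedDeriv, iteratedDeriv_eq_iterate,
          Real.iter_deriv_exp, Real.norm_eq_abs, Real.abs_exp]
      · intro i hi hin
        have hone : 1 ≤ (1 + C) * (1 + ‖x‖) ^ p :=
          one_le_mul_of_one_le_of_one_le (by linarith)
            (one_le_pow₀ (by linarith [norm_nonneg x]))
        -- The composition estimate needs a bound D^i for the i-th derivative; as D ≥ 1 and i ≥ 1,
        -- the uniform bound D suffices.
        refine le_trans ?_ (le_self_pow₀ hone (by omega))
        refine (hC i hin x).trans ?_
        gcongr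
        linarith
    calc ‖x‖ ^ k * ‖iteratedFDeriv ℝ n (Real.exp ∘ f) x‖
        ≤ (1 + ‖x‖) ^ k * (n.factorial * Real.exp (-(c * ‖x‖ ^ 2)) *
          ((1 + C) * (1 + ‖x‖) ^ p) ^ n) := by
          gcongr
          · linarith
          · refine h1.trans ?_
            gcongr
            exact hb x
      _ = n.factorial * (1 + C) ^ n *
          ((1 + ‖x‖) ^ (k + p * n) * Real.exp (-(c * ‖x‖ ^ 2))) := by
          rw [mul_pow, pow_add, pow_mul]; ring
      _ ≤ _ := by
          exact mul_le_mul_of_nonneg_left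
            (one_add_pow_mul_exp_neg_le _ hc (norm_nonneg x)) (by positivity)

theorem spheroidForm_hasTemperateGrowth (δ : ℝ) (e : V) :
    (fun x => -spheroidForm δ e x).HasTemperateGrowth := by
  unfold spheroidForm
  fun_prop

theorem exists_schwartz_hermite {δ : ℝ} (hδ0 : 0 < δ) (hδ : δ ≤ 1) (e : V) :
    ∃ φ : 𝓢(V, ℂ), ∀ x, φ x =
      ((4 * inner ℝ e x ^ 2 - 2) * Real.exp (-spheroidForm δ e x) : ℝ) := by
  let g : 𝓢(V, ℝ) := schwartzExp (spheroidForm_hasTemperateGrowth δ e) hδ0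
    (fun x => neg_le_neg (le_spheroidForm hδ e x))
  have hp : (fun x : V => 4 * inner ℝ e x ^ 2 - 2).HasTemperateGrowth := by fun_prop
  refine ⟨(SchwartzMap.smulLeftCLM ℝ (fun x : V => 4 * inner ℝ e x ^ 2 - 2) g).postcompCLM
    Complex.ofRealCLM, fun x => ?_⟩
  rw [SchwartzMap.postcompCLM_apply, SchwartzMap.smulLeftCLM_apply_apply hp]
  rfl

end Schwartz

/-! ### The test function as an autocorrelation, and failure of positive definiteness. -/

section Convolution

theorem integral_even_quartic_mul_gauss (A B D : ℝ) :
    ∫ s : ℝ, (A * s ^ 4 + B * s ^ 2 + D) * Real.exp (-(4 * s ^ 2 / 2)) =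
      gaussMoment 0 * (3 * A / 16 + B / 4 + D) := by
  have habs := integral_comp_abs
    (f := fun s : ℝ => (A * s ^ 4 + B * s ^ 2 + D) * Real.exp (-(4 * s ^ 2 / 2)))
  have h4 : ∀ t : ℝ, |t| ^ 4 = t ^ 4 := fun t => by
    rw [show (4 : ℕ) = 2 * 2 from rfl, pow_mul, sq_abs, pow_mul]
  simp only [sq_abs, h4] at habs
  have hi := fun j : ℕ => (integrable_pow_mul_gauss j (four_pos (α := ℝ))).integrableOn
    (s := Set.Ioi 0)
  have hv := fun j : ℕ => integral_pow_mul_gauss j (four_pos (α := ℝ))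
  have hexp : ∀ s : ℝ, (A * s ^ 4 + B * s ^ 2 + D) * Real.exp (-(4 * s ^ 2 / 2)) =
      A * (s ^ (0 + 2 + 2) * Real.exp (-(4 * s ^ 2 / 2)))
        + B * (s ^ (0 + 2) * Real.exp (-(4 * s ^ 2 / 2)))
        + D * (s ^ 0 * Real.exp (-(4 * s ^ 2 / 2))) := fun s => by ring
  rw [habs]
  simp only [hexp]
  have ha := (hi (0 + 2 + 2)).const_mul A
  have hb := (hi (0 + 2)).const_mul B
  rw [integral_add (by exact ha.add hb) (by exact (hi 0).const_mul D),
    integral_add (by exact ha) (by exact hb), integral_const_mul, integral_const_mul,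
    integral_const_mul, hv, hv, hv, gaussMoment_add_two, gaussMoment_add_two]
  have h1 : (4 : ℝ) ^ (-(((0 : ℕ) : ℝ) + 1) / 2) = 1 / 2 := by
    rw [show (4 : ℝ) = 2 ^ (2 : ℝ) by norm_num, ← Real.rpow_mul zero_le_two]
    norm_num [Real.rpow_neg_one]
  have h2 : -(((0 + 2 : ℕ) : ℝ) + 1) / 2 = -(((0 : ℕ) : ℝ) + 1) / 2 - 1 := by push_cast; ring
  have h3 : -(((0 + 2 + 2 : ℕ) : ℝ) + 1) / 2 = -(((0 : ℕ) : ℝ) + 1) / 2 - 1 - 1 := by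
    push_cast; ring
  rw [h2, h3, Real.rpow_sub_one four_ne_zero, Real.rpow_sub_one four_ne_zero, h1]
  push_cast
  ring

variable {V : Type*} [NormedAddCommGroup V] [InnerProductSpace ℝ V] [FiniteDimensional ℝ V]
  [MeasurableSpace V] [BorelSpace V]

/-- Here φ is the second derivative along `e` of exp(-`spheroidForm`). The autocorrelation of that
Gaussian is a multiple of exp(-`spheroidForm`/2), and the two pairs of derivatives combine into a
fourth derivative. -/
theorem exists_convolution_hermite {δ : ℝ} (hδ0 : 0 < δ) {e : V} (he : ‖e‖ = 1) {φ : V → ℂ}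
    (hφ : ∀ x, φ x = ((4 * inner ℝ e x ^ 2 - 2) * Real.exp (-spheroidForm δ e x) : ℝ)) :
    ∃ κ : ℝ, 0 < κ ∧ ∀ x, convolution (fun y => φ y) (fun y => conj (φ (-y)))
      (ContinuousLinearMap.mul ℂ ℂ) volume x = (κ * testFun δ e x : ℝ) := by
  set W := (Submodule.span ℝ {e})ᗮ
  have hpos : 0 < ∫ y : W, Real.exp (-(2 * δ * ‖y‖ ^ 2)) := by
    have hint : Integrable (fun y : W => Real.exp (-(2 * δ * ‖y‖ ^ 2))) := by
      have hf : (fun y : W => -(2 * δ * ‖y‖ ^ 2)).HasTemperateGrowth := by fun_prop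
      exact (schwartzExp hf (by positivity : 0 < 2 * δ) fun y => le_rfl).integrable
    exact integral_exp_pos hint
  refine ⟨gaussMoment 0 * ∫ y : W, Real.exp (-(2 * δ * ‖y‖ ^ 2)),
    mul_pos (gaussMoment_pos 0) hpos, fun x => ?_⟩
  have h1 : convolution (fun y => φ y) (fun y => conj (φ (-y)))
      (ContinuousLinearMap.mul ℂ ℂ) volume x =
      ((∫ y : V, (4 * inner ℝ e y ^ 2 - 2) * Real.exp (-spheroidForm δ e y) *
        ((4 * inner ℝ e (y - x) ^ 2 - 2) * Real.exp (-spheroidForm δ e (y - x))) : ℝ) : ℂ) := by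
    rw [convolution, ← integral_complex_ofReal]
    refine integral_congr_ae (Filter.Eventually.of_forall fun y => ?_)
    simp only [ContinuousLinearMap.mul_apply', hφ, Complex.conj_ofReal, neg_sub]
    push_cast
    ring
  rw [h1]
  congr 1
  -- Centring at x/2 makes the two arguments z ± x/2; the parallelogram law then separates x from z
  -- in the exponent.
  rw [← integral_add_right_eq_self _ ((2 : ℝ)⁻¹ • x), integral_lineProd he]
  have hsplit : ∀ p : ℝ × W,
      (4 * inner ℝ e (p.1 • e + (p.2 : V) + (2 : ℝ)⁻¹ • x) ^ 2 - 2) *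
        Real.exp (-spheroidForm δ e (p.1 • e + (p.2 : V) + (2 : ℝ)⁻¹ • x)) *
        ((4 * inner ℝ e (p.1 • e + (p.2 : V) + (2 : ℝ)⁻¹ • x - x) ^ 2 - 2) *
          Real.exp (-spheroidForm δ e (p.1 • e + (p.2 : V) + (2 : ℝ)⁻¹ • x - x))) =
      ((Real.exp (-(spheroidForm δ e x / 2)) * 16 * p.1 ^ 4 +
        Real.exp (-(spheroidForm δ e x / 2)) * (-8 * inner ℝ e x ^ 2 - 16) * p.1 ^ 2 +
        Real.exp (-(spheroidForm δ e x / 2)) * (inner ℝ e x ^ 4 - 4 * inner ℝ e x ^ 2 + 4)) *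
        Real.exp (-(4 * p.1 ^ 2 / 2))) * Real.exp (-(2 * δ * ‖p.2‖ ^ 2)) := by
    intro p
    set z : V := p.1 • e + (p.2 : V) with hz
    have hz1 : inner ℝ e z = p.1 := inner_lineProd he p.1 p.2
    have hz2 : ‖z‖ ^ 2 = p.1 ^ 2 + ‖p.2‖ ^ 2 := norm_sq_lineProd he p.1 p.2
    have hsub : z + (2 : ℝ)⁻¹ • x - x = z - (2 : ℝ)⁻¹ • x := by module
    have hpar : spheroidForm δ e (z + (2 : ℝ)⁻¹ • x) + spheroidForm δ e (z - (2 : ℝ)⁻¹ • x) =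
        spheroidForm δ e x / 2 + 4 * p.1 ^ 2 / 2 + 2 * δ * ‖p.2‖ ^ 2 := by
      simp only [spheroidForm, inner_add_right, inner_sub_right, inner_smul_right, hz1]
      rw [norm_add_sq_real, norm_sub_sq_real, hz2, norm_smul, mul_pow]
      norm_num
      ring
    have hexp : Real.exp (-spheroidForm δ e (z + (2 : ℝ)⁻¹ • x)) *
        Real.exp (-spheroidForm δ e (z - (2 : ℝ)⁻¹ • x)) =
        Real.exp (-(spheroidForm δ e x / 2)) * Real.exp (-(4 * p.1 ^ 2 / 2)) *
          Real.exp (-(2 * δ * ‖p.2‖ ^ 2)) := by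
      rw [← Real.exp_add, ← Real.exp_add, ← Real.exp_add]
      congr 1
      linarith
    rw [hsub]
    have hi1 : inner ℝ e (z + (2 : ℝ)⁻¹ • x) = p.1 + inner ℝ e x / 2 := by
      rw [inner_add_right, inner_smul_right, hz1]; ring
    have hi2 : inner ℝ e (z - (2 : ℝ)⁻¹ • x) = p.1 - inner ℝ e x / 2 := by
      rw [inner_sub_right, inner_smul_right, hz1]; ring
    rw [hi1, hi2]
    linear_combination (4 * (p.1 + inner ℝ e x / 2) ^ 2 - 2) *
      (4 * (p.1 - inner ℝ e x / 2) ^ 2 - 2) * hexp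
  simp only [hsplit]
  rw [integral_prod_mul (fun s : ℝ => (Real.exp (-(spheroidForm δ e x / 2)) * 16 * s ^ 4 +
        Real.exp (-(spheroidForm δ e x / 2)) * (-8 * inner ℝ e x ^ 2 - 16) * s ^ 2 +
        Real.exp (-(spheroidForm δ e x / 2)) * (inner ℝ e x ^ 4 - 4 * inner ℝ e x ^ 2 + 4)) *
        Real.exp (-(4 * s ^ 2 / 2))) (fun y : W => Real.exp (-(2 * δ * ‖y‖ ^ 2))),
    integral_even_quartic_mul_gauss, testFun]
  ring

theorem not_isPositiveDefiniteDistribution_of_integral_neg {n : ℕ} {g ρ : E n → ℝ}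
    (hg : ∀ x, x ≠ 0 → g x = ρ x) [Nontrivial (E n)] {δ : ℝ} (hδ0 : 0 < δ) (hδ : δ ≤ 1)
    {e : E n} (he : ‖e‖ = 1) (hneg : ∫ x, ρ x * testFun δ e x < 0) :
    ¬ IsPositiveDefiniteDistribution g := by
  intro h
  obtain ⟨φ, hφ⟩ := exists_schwartz_hermite hδ0 hδ e
  obtain ⟨κ, hκ, hconv⟩ := exists_convolution_hermite hδ0 he hφ
  have h1 := h φ
  have h2 : ∫ x : E n, (g x : ℂ) *
      convolution (fun y => φ y) (fun y => conj (φ (-y))) (ContinuousLinearMap.mul ℂ ℂ) volume x =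
      ((κ * ∫ x, ρ x * testFun δ e x : ℝ) : ℂ) := by
    rw [← integral_const_mul, ← integral_complex_ofReal]
    refine integral_congr_ae ?_
    -- The functions g and ρ may differ at the origin, a null set.
    filter_upwards [Measure.ae_ne volume (0 : E n)] with x hx
    rw [hconv, hg x hx]
    push_cast
    ring
  rw [h2, Complex.zero_le_real] at h1
  exact (mul_neg_of_pos_of_neg hκ hneg).not_ge h1

theorem not_isPositiveDefiniteDistribution_revolutionBody {ε : ℝ} (hε : 3 / 4 < ε) (hε1 : ε < 1) :
    ¬ IsPositiveDefiniteDistribution (radialFunction (revolutionBody ε)) := by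
  obtain ⟨δ, hδ0, hδ1, hneg⟩ := exists_integral_revolutionRadial_neg hε hε1
  have : Nontrivial (E 5) := Module.nontrivial_of_finrank_pos (R := ℝ) (by simp)
  exact not_isPositiveDefiniteDistribution_of_integral_neg
    (fun x hx => radialFunction_revolutionBody (by linarith) hx) hδ0 hδ1 (norm_axis 4) hneg

end Convolution

/-! ### Stability of convexity under C² perturbation of a 2-homogeneous function. -/

section Convexity

variable {V : Type*} [NormedAddCommGroup V] [InnerProductSpace ℝ V]

theorem hasDerivAt_line {Y : Type*} [NormedAddCommGroup Y] [NormedSpace ℝ Y] (p v : Y) (s : ℝ) :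
    HasDerivAt (fun s : ℝ => p + s • v) v s := by
  simpa using ((hasDerivAt_id s).smul_const v).const_add p

theorem deriv_deriv_line {Y : Type*} [NormedAddCommGroup Y] [NormedSpace ℝ Y] {T : Y → ℝ} {p : Y}
    (hT : ContDiffAt ℝ 2 T p) (v : Y) :
    deriv (deriv fun s : ℝ => T (p + s • v)) 0 = fderiv ℝ (fderiv ℝ T) p v v := by
  have hev : ∀ᶠ q in nhds p, ContDiffAt ℝ 2 T q := hT.eventually (by simp)
  have hcont : Filter.Tendsto (fun s : ℝ => p + s • v) (nhds 0) (nhds p) := by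
    have : Continuous fun s : ℝ => p + s • v := by fun_prop
    simpa using this.tendsto 0
  have h1 : deriv (fun s : ℝ => T (p + s • v)) =ᶠ[nhds 0] fun s => fderiv ℝ T (p + s • v) v := by
    filter_upwards [hcont.eventually hev] with s hs
    exact ((hs.differentiableAt (by simp)).hasFDerivAt.comp_hasDerivAt s
      (hasDerivAt_line p v s)).deriv
  rw [h1.deriv_eq]
  have hT2 : HasFDerivAt (fderiv ℝ T) (fderiv ℝ (fderiv ℝ T) p) (p + (0 : ℝ) • v) := by
    rw [zero_smul, add_zero]
    exact ((hT.fderiv_right (m := 1) (by norm_num)).differentiableAt (by simp)).hasFDerivAt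
  have h2 : HasDerivAt (fun s : ℝ => fderiv ℝ T (p + s • v)) (fderiv ℝ (fderiv ℝ T) p v) 0 :=
    hT2.comp_hasDerivAt (0 : ℝ) (hasDerivAt_line p v 0)
  have h3 := ((ContinuousLinearMap.apply ℝ ℝ v).hasFDerivAt (x := fderiv ℝ T (p + (0 : ℝ) • v))
    ).comp_hasDerivAt (0 : ℝ) h2
  exact h3.deriv

theorem deriv_deriv_comp_mul_left (f : ℝ → ℝ) (c m : ℝ) :
    deriv (deriv fun s => m * f (c * s)) 0 = m * c ^ 2 * deriv (deriv f) 0 := by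
  have h1 : deriv (fun s => m * f (c * s)) = fun s => m * c * deriv f (c * s) := by
    ext s
    rw [deriv_const_mul_field, deriv_comp_mul_left, smul_eq_mul]
    ring
  rw [h1, deriv_const_mul_field, deriv_comp_mul_left, smul_eq_mul, mul_zero]
  ring

/-- Homogeneity carries smoothness and the second-derivative condition from the sphere to all
non-zero points. A line missing the origin is then covered by the one-variable criterion. -/
theorem convexOn_of_deriv_deriv_sphere_nonneg {g : V → ℝ}
    (hhom : ∀ (r : ℝ) (x : V), g (r • x) = r ^ 2 * g x)
    (hC : ∀ u : V, ‖u‖ = 1 → ContDiffAt ℝ 2 g u) (hpos : ∀ u : V, ‖u‖ = 1 → 0 ≤ g u)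
    (hd : ∀ u v : V, ‖u‖ = 1 → ‖v‖ = 1 → 0 ≤ deriv (deriv fun s : ℝ => g (u + s • v)) 0) :
    ConvexOn ℝ Set.univ g := by
  have hunit : ∀ z : V, z ≠ 0 → ‖‖z‖⁻¹ • z‖ = 1 := fun z hz => by
    rw [norm_smul, norm_inv, norm_norm, inv_mul_cancel₀ (norm_ne_zero_iff.2 hz)]
  have hself : ∀ z : V, z ≠ 0 → z = ‖z‖ • (‖z‖⁻¹ • z) := fun z hz => by
    rw [smul_smul, mul_inv_cancel₀ (norm_ne_zero_iff.2 hz), one_smul]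
  have hpos' : ∀ z : V, 0 ≤ g z := fun z => by
    rcases eq_or_ne z 0 with rfl | hz
    · have := hhom 0 0
      simp at this
      simp [this]
    · rw [hself z hz, hhom]
      exact mul_nonneg (sq_nonneg _) (hpos _ (hunit z hz))
  have hC' : ∀ z : V, z ≠ 0 → ContDiffAt ℝ 2 g z := fun z hz => by
    have h1 : g = fun x => ‖z‖ ^ 2 * g (‖z‖⁻¹ • x) := by
      ext x
      rw [← hhom, smul_smul, mul_inv_cancel₀ (norm_ne_zero_iff.2 hz), one_smul]
    rw [h1]
    refine contDiffAt_const.mul ?_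
    exact ContDiffAt.comp z (hC _ (hunit z hz)) (by fun_prop)
  have hd' : ∀ z v : V, z ≠ 0 → 0 ≤ deriv (deriv fun s : ℝ => g (z + s • v)) 0 := by
    intro z v hz
    obtain ⟨w, hw, m, hm⟩ : ∃ w : V, ‖w‖ = 1 ∧ ∃ m : ℝ, v = m • w := by
      rcases eq_or_ne v 0 with rfl | hv
      · exact ⟨_, hunit z hz, 0, by simp⟩
      · exact ⟨_, hunit v hv, ‖v‖, hself v hv⟩
    have h1 : (fun s : ℝ => g (z + s • v)) = fun s =>
        ‖z‖ ^ 2 * (fun s : ℝ => g (‖z‖⁻¹ • z + s • w)) ((‖z‖⁻¹ * m) * s) := by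
      ext s
      simp only
      rw [← hhom]
      congr 1
      rw [smul_add, smul_smul, smul_smul, mul_inv_cancel₀ (norm_ne_zero_iff.2 hz), one_smul, hm,
        smul_smul]
      congr 2
      field_simp [norm_ne_zero_iff.2 hz]
    rw [h1, deriv_deriv_comp_mul_left (fun s : ℝ => g (‖z‖⁻¹ • z + s • w))]
    have := hd _ w (hunit z hz) hw
    positivity
  refine ⟨convex_univ, fun a _ b _ α β hα hβ hαβ => ?_⟩
  -- On a line through the origin, where g need not be C², g is a non-negative multiple of a square
  -- by homogeneity.
  by_cases h0 : ∃ s : ℝ, a + s • (b - a) = 0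
  · obtain ⟨s, hs⟩ := h0
    have ha : a = (-s) • (b - a) := by
      rw [neg_smul]; exact eq_neg_of_add_eq_zero_left hs
    have hb : b = (1 - s) • (b - a) := by
      calc b = (b - a) + a := by abel
        _ = (b - a) + (-s) • (b - a) := congrArg ((b - a) + ·) ha
        _ = (1 - s) • (b - a) := by module
    generalize b - a = v at ha hb
    subst ha hb
    rw [smul_smul, smul_smul, ← add_smul, hhom, hhom, hhom, smul_eq_mul, smul_eq_mul]
    have : (α * -s + β * (1 - s)) ^ 2 ≤ α * (-s) ^ 2 + β * (1 - s) ^ 2 := by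
      have hβ' : β = 1 - α := by linarith
      subst hβ'
      nlinarith [mul_nonneg hα hβ]
    calc _ ≤ (α * (-s) ^ 2 + β * (1 - s) ^ 2) * g v := mul_le_mul_of_nonneg_right this (hpos' v)
      _ = _ := by ring
  · push Not at h0
    set f : ℝ → ℝ := fun s => g (a + s • (b - a)) with hf
    have hfC : ContDiff ℝ 2 f := contDiff_iff_contDiffAt.2 fun s =>
      ContDiffAt.comp s (hC' _ (h0 s)) (by fun_prop)
    have hfd : ContDiff ℝ 1 (deriv f) := by
      have := (contDiff_succ_iff_deriv (n := 1) (f := f)).1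
        (by rw [one_add_one_eq_two]; exact hfC)
      exact this.2.2
    have hconv : ConvexOn ℝ Set.univ f := by
      refine convexOn_of_deriv2_nonneg' convex_univ (hfC.differentiable (by simp)).differentiableOn
        (hfd.differentiable (by simp)).differentiableOn fun s _ => ?_
      have h1 : deriv (deriv fun σ : ℝ => f (s + σ)) 0 = deriv (deriv f) s := by
        have : (deriv fun σ : ℝ => f (s + σ)) = fun σ => deriv f (s + σ) := by
          ext σ; exact deriv_comp_const_add f s σ
        rw [this, deriv_comp_const_add, add_zero]
      have h2 : (fun σ : ℝ => f (s + σ)) = fun σ => g ((a + s • (b - a)) + σ • (b - a)) := by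
        ext σ
        simp only [hf, add_smul, add_assoc]
      rw [Function.iterate_succ, Function.iterate_one, Function.comp_apply, ← h1, h2]
      exact hd' _ _ (h0 s)
    have := hconv.2 (Set.mem_univ (0 : ℝ)) (Set.mem_univ (1 : ℝ)) hα hβ hαβ
    simp only [hf, smul_eq_mul, mul_zero, zero_add, mul_one, zero_smul, add_zero, one_smul] at this
    have hβ' : α • a + β • b = a + β • (b - a) := by
      have : α = 1 - β := by linarith
      subst this
      module
    rw [hβ']
    simpa using this

variable [FiniteDimensional ℝ V]

/-- At η = 0 the second derivative in a unit direction is 2τ > 0. Joint C² regularity and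
compactness of the product of two spheres keep it positive for all small η. -/
theorem eventually_convexOn_of_homogeneous_family {T : ℝ × V → ℝ}
    (hhom : ∀ᶠ η in nhds (0 : ℝ), ∀ (r : ℝ) (x : V), T (η, r • x) = r ^ 2 * T (η, x))
    (hC : ∀ u : V, ‖u‖ = 1 → ContDiffAt ℝ 2 T (0, u)) {τ : ℝ} (hτ : 0 < τ)
    (hT0 : ∀ x, T (0, x) = τ * ‖x‖ ^ 2) :
    ∀ᶠ η in nhds (0 : ℝ), ConvexOn ℝ Set.univ fun x => T (η, x) := by
  have key : ∀ p ∈ sphere (0 : V) 1 ×ˢ sphere (0 : V) 1, ∀ᶠ q : ℝ × (V × V) in nhds (0, p),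
      ContDiffAt ℝ 2 T (q.1, q.2.1) ∧ 0 < T (q.1, q.2.1) ∧
        0 < fderiv ℝ (fderiv ℝ T) (q.1, q.2.1) (0, q.2.2) (0, q.2.2) := by
    rintro ⟨u, v⟩ ⟨hu, hv⟩
    rw [mem_sphere_zero_iff_norm] at hu hv
    simp only at hu hv
    have hCu := hC u hu
    have hproj : Filter.Tendsto (fun q : ℝ × (V × V) => (q.1, q.2.1)) (nhds (0, (u, v)))
        (nhds (0, u)) := by
      have : Continuous fun q : ℝ × (V × V) => (q.1, q.2.1) := by fun_prop
      exact this.tendsto (0, (u, v))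
    have e1 := hproj.eventually (hCu.eventually (by simp))
    have e2 : ∀ᶠ q : ℝ × (V × V) in nhds (0, (u, v)), 0 < T (q.1, q.2.1) := by
      refine hproj.eventually (hCu.continuousAt.eventually_const_lt ?_)
      rw [hT0, hu]
      simpa using hτ
    have e3 : ∀ᶠ q : ℝ × (V × V) in nhds (0, (u, v)),
        0 < fderiv ℝ (fderiv ℝ T) (q.1, q.2.1) (0, q.2.2) (0, q.2.2) := by
      have hc : ContinuousAt (fderiv ℝ (fderiv ℝ T)) (0, u) :=
        ((hCu.fderiv_right (m := 1) (by norm_num)).fderiv_right (m := 0)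
          (by norm_num)).continuousAt
      have hc' : ContinuousAt (fun q : ℝ × (V × V) =>
          fderiv ℝ (fderiv ℝ T) (q.1, q.2.1) (0, q.2.2) (0, q.2.2)) (0, (u, v)) := by
        have hA : ContinuousAt (fun q : ℝ × (V × V) => fderiv ℝ (fderiv ℝ T) (q.1, q.2.1))
          (0, (u, v)) := hc.tendsto.comp hproj
        have hB : ContinuousAt (fun q : ℝ × (V × V) => ((0 : ℝ), q.2.2)) (0, (u, v)) := by
          fun_prop
        exact (hA.clm_apply hB).clm_apply hB
      refine hc'.eventually_const_lt ?_
      simp only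
      rw [← deriv_deriv_line hCu]
      have h1 : (fun s : ℝ => T ((0, u) + s • (0, v))) = fun s =>
          τ * (‖u‖ ^ 2 + 2 * s * inner ℝ u v + s ^ 2 * ‖v‖ ^ 2) := by
        ext s
        have : ((0 : ℝ), u) + s • ((0 : ℝ), v) = (0, u + s • v) := by simp
        rw [this, hT0, norm_add_sq_real, inner_smul_right, norm_smul, mul_pow, Real.norm_eq_abs,
          sq_abs]
        ring
      have h2 : deriv (fun s : ℝ => τ * (‖u‖ ^ 2 + 2 * s * inner ℝ u v + s ^ 2 * ‖v‖ ^ 2)) =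
          fun s => τ * (2 * inner ℝ u v + 2 * s * ‖v‖ ^ 2) := by
        ext s
        have := (((((hasDerivAt_id s).const_mul 2).mul_const (inner ℝ u v)).const_add
          (‖u‖ ^ 2)).add ((hasDerivAt_pow 2 s).mul_const (‖v‖ ^ 2))).const_mul τ
        refine HasDerivAt.deriv ?_
        refine this.congr_deriv ?_
        simp
      have h3 : HasDerivAt (fun s : ℝ => τ * (2 * inner ℝ u v + 2 * s * ‖v‖ ^ 2))
          (τ * (2 * ‖v‖ ^ 2)) 0 := by
        have := ((((hasDerivAt_id (0 : ℝ)).const_mul 2).mul_const (‖v‖ ^ 2)).const_add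
          (2 * inner ℝ u v)).const_mul τ
        refine this.congr_deriv ?_
        simp
      rw [h1, h2, h3.deriv, hv]
      positivity
    exact e1.and (e2.and e3)
  have htube := ((isCompact_sphere (0 : V) 1).prod
    (isCompact_sphere (0 : V) 1)).eventually_forall_of_forall_eventually (x₀ := (0 : ℝ))
    (P := fun η p => ContDiffAt ℝ 2 T (η, p.1) ∧ 0 < T (η, p.1) ∧
        0 < fderiv ℝ (fderiv ℝ T) (η, p.1) (0, p.2) (0, p.2)) key
  filter_upwards [htube, hhom] with η hη hhomη
  have hη' : ∀ u v : V, ‖u‖ = 1 → ‖v‖ = 1 → ContDiffAt ℝ 2 T (η, u) ∧ 0 < T (η, u) ∧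
        0 < fderiv ℝ (fderiv ℝ T) (η, u) (0, v) (0, v) := fun u v hu hv =>
    hη (u, v) ⟨mem_sphere_zero_iff_norm.2 hu, mem_sphere_zero_iff_norm.2 hv⟩
  refine convexOn_of_deriv_deriv_sphere_nonneg hhomη (fun u hu => ?_) (fun u hu => ?_)
    (fun u v hu hv => ?_)
  · exact ContDiffAt.comp u (hη' u u hu hu).1 (by fun_prop)
  · exact (hη' u u hu hu).2.1.le
  · have h := hη' u v hu hv
    have := deriv_deriv_line h.1 (0, v)
    have heq : (fun s : ℝ => T ((η, u) + s • (0, v))) = fun s => T (η, u + s • v) := by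
      ext s; simp
    rw [heq] at this
    rw [this]
    exact h.2.2.le

end Convexity

/-! ### The ℓ^(2n)-sum of a hyperplane and a line. -/

section LpSum

variable {V : Type*} [NormedAddCommGroup V] [InnerProductSpace ℝ V]

/-- The square of the norm of the `ℓ^(2n)`-sum of `e^⊥` and the line spanned by the unit vector
`e`. -/
noncomputable def lpSumSq (n : ℕ) (e x : V) : ℝ :=
  ((‖x‖ ^ 2 - inner ℝ e x ^ 2) ^ n + (inner ℝ e x ^ 2) ^ n) ^ (1 / n : ℝ)

variable {e : V} {n : ℕ}

theorem norm_sq_sub_inner_sq (he : ‖e‖ = 1) (x : V) :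
    ‖x‖ ^ 2 - inner ℝ e x ^ 2 = ‖x - inner ℝ e x • e‖ ^ 2 := by
  rw [norm_sub_sq_real, inner_smul_right, norm_smul, he, real_inner_comm, Real.norm_eq_abs,
    mul_one, sq_abs]
  ring

theorem norm_sq_sub_inner_sq_nonneg (he : ‖e‖ = 1) (x : V) : 0 ≤ ‖x‖ ^ 2 - inner ℝ e x ^ 2 :=
  sub_nonneg.2 (inner_sq_le_norm_sq he.le x)

theorem lpSumSq_nonneg (he : ‖e‖ = 1) (n : ℕ) (x : V) : 0 ≤ lpSumSq n e x :=
  Real.rpow_nonneg (add_nonneg (pow_nonneg (norm_sq_sub_inner_sq_nonneg he x) n)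
    (pow_nonneg (sq_nonneg _) n)) _

theorem pow_rpow_one_div {a : ℝ} (ha : 0 ≤ a) (hn : n ≠ 0) : (a ^ n) ^ (1 / n : ℝ) = a := by
  rw [one_div, Real.pow_rpow_inv_natCast ha hn]

theorem half_norm_sq_le_lpSumSq (he : ‖e‖ = 1) (hn : n ≠ 0) (x : V) :
    ‖x‖ ^ 2 / 2 ≤ lpSumSq n e x := by
  have ha := norm_sq_sub_inner_sq_nonneg he x
  have hb := sq_nonneg (inner ℝ e x)
  have h1 : ‖x‖ ^ 2 - inner ℝ e x ^ 2 ≤ lpSumSq n e x := by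
    conv_lhs => rw [← pow_rpow_one_div ha hn]
    exact Real.rpow_le_rpow (by positivity) (by linarith [pow_nonneg hb n]) (by positivity)
  have h2 : inner ℝ e x ^ 2 ≤ lpSumSq n e x := by
    conv_lhs => rw [← pow_rpow_one_div hb hn]
    exact Real.rpow_le_rpow (by positivity) (by linarith [pow_nonneg ha n]) (by positivity)
  linarith

theorem lpSumSq_pos (he : ‖e‖ = 1) (hn : n ≠ 0) {x : V} (hx : x ≠ 0) : 0 < lpSumSq n e x := by
  have : 0 < ‖x‖ := norm_pos_iff.2 hx
  exact (by positivity : 0 < ‖x‖ ^ 2 / 2).trans_le (half_norm_sq_le_lpSumSq he hn x)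

theorem lpSumSq_smul (he : ‖e‖ = 1) (hn : n ≠ 0) (r : ℝ) (x : V) :
    lpSumSq n e (r • x) = r ^ 2 * lpSumSq n e x := by
  have ha := norm_sq_sub_inner_sq_nonneg he x
  have h : (‖r • x‖ ^ 2 - inner ℝ e (r • x) ^ 2) ^ n + (inner ℝ e (r • x) ^ 2) ^ n =
      (r ^ 2) ^ n * ((‖x‖ ^ 2 - inner ℝ e x ^ 2) ^ n + (inner ℝ e x ^ 2) ^ n) := by
    rw [norm_smul, inner_smul_right, mul_pow, mul_pow, Real.norm_eq_abs, sq_abs, ← mul_sub,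
      mul_pow, mul_pow]
    ring
  rw [lpSumSq, h, Real.mul_rpow (by positivity) (add_nonneg (pow_nonneg ha n) (by positivity)),
    pow_rpow_one_div (sq_nonneg r) hn]
  rfl

/-- This is the ℓⁿ-norm of the pair (|y|², t²). Both entries are non-negative convex functions and
the norm is monotone on non-negative pairs, so Minkowski's inequality applies. -/
theorem convexOn_lpSumSq (he : ‖e‖ = 1) (hn : n ≠ 0) : ConvexOn ℝ Set.univ (lpSumSq n e) := by
  have hconv1 : ConvexOn ℝ Set.univ fun x : V => ‖x‖ ^ 2 - inner ℝ e x ^ 2 := by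
    have h : ConvexOn ℝ Set.univ fun x : V => ‖x - inner ℝ e x • e‖ := by
      refine ⟨convex_univ, fun x _ y _ a b ha hb _ => ?_⟩
      have : a • x + b • y - inner ℝ e (a • x + b • y) • e =
          a • (x - inner ℝ e x • e) + b • (y - inner ℝ e y • e) := by
        rw [inner_add_right, inner_smul_right, inner_smul_right]
        module
      beta_reduce
      rw [this]
      refine (norm_add_le _ _).trans_eq ?_
      rw [norm_smul, norm_smul, Real.norm_of_nonneg ha, Real.norm_of_nonneg hb]
      rfl
    have := h.pow (fun x _ => norm_nonneg _) 2
    refine this.congr fun x _ => ?_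
    exact (norm_sq_sub_inner_sq he x).symm
  have hconv2 : ConvexOn ℝ Set.univ fun x : V => inner ℝ e x ^ 2 :=
    (Even.convexOn_pow (𝕜 := ℝ) (by decide : Even 2)).comp_linearMap (innerₛₗ ℝ e)
  refine ⟨convex_univ, fun x _ y _ a b ha hb hab => ?_⟩
  have h1 := hconv1.2 (Set.mem_univ x) (Set.mem_univ y) ha hb hab
  have h2 := hconv2.2 (Set.mem_univ x) (Set.mem_univ y) ha hb hab
  have hnonneg := norm_sq_sub_inner_sq_nonneg he
  have hn1 : (1 : ℝ) ≤ n := by exact_mod_cast Nat.one_le_iff_ne_zero.2 hn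
  have hmink := Real.Lp_add_le_of_nonneg (s := (Finset.univ : Finset (Fin 2)))
    (f := ![a * (‖x‖ ^ 2 - inner ℝ e x ^ 2), a * inner ℝ e x ^ 2])
    (g := ![b * (‖y‖ ^ 2 - inner ℝ e y ^ 2), b * inner ℝ e y ^ 2]) hn1
    (by intro i _; fin_cases i
        · exact mul_nonneg ha (hnonneg x)
        · exact mul_nonneg ha (sq_nonneg _))
    (by intro i _; fin_cases i
        · exact mul_nonneg hb (hnonneg y)
        · exact mul_nonneg hb (sq_nonneg _))
  simp only [Fin.sum_univ_two, Matrix.cons_val_zero, Matrix.cons_val_one,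
    Real.rpow_natCast] at hmink
  have hscale : ∀ (c : ℝ) (z : V), 0 ≤ c → ((c * (‖z‖ ^ 2 - inner ℝ e z ^ 2)) ^ n +
      (c * inner ℝ e z ^ 2) ^ n) ^ (1 / n : ℝ) = c * lpSumSq n e z := fun c z hc => by
    rw [mul_pow, mul_pow, ← mul_add, Real.mul_rpow (by positivity)
      (add_nonneg (pow_nonneg (hnonneg z) n) (by positivity)), pow_rpow_one_div hc hn]
    rfl
  rw [hscale a x ha, hscale b y hb] at hmink
  refine le_trans ?_ hmink
  simp only [smul_eq_mul] at h1 h2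
  refine Real.rpow_le_rpow (add_nonneg (pow_nonneg (hnonneg _) n) (by positivity)) ?_
    (by positivity)
  exact add_le_add (pow_le_pow_left₀ (hnonneg _) h1 n) (pow_le_pow_left₀ (sq_nonneg _) h2 n)

theorem contDiffAt_lpSumSq (he : ‖e‖ = 1) {x : V} (hx : x ≠ 0) :
    ContDiffAt ℝ 2 (lpSumSq n e) x := by
  have ha := norm_sq_sub_inner_sq_nonneg he x
  have hpos : (‖x‖ ^ 2 - inner ℝ e x ^ 2) ^ n + (inner ℝ e x ^ 2) ^ n ≠ 0 := by
    have hx0 : 0 < ‖x‖ ^ 2 := by have := norm_pos_iff.2 hx; positivity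
    rcases eq_or_ne (inner ℝ e x) 0 with h0 | h0
    · have h1 : 0 < ‖x‖ ^ 2 - inner ℝ e x ^ 2 := by rw [h0]; simpa using hx0
      have := pow_pos h1 n
      positivity
    · have h1 := pow_nonneg ha n
      positivity
  unfold lpSumSq
  refine ContDiffAt.rpow_const_of_ne ?_ hpos
  have h1 : ContDiffAt ℝ 2 (fun x : V => ‖x‖ ^ 2) x := contDiffAt_id.norm_sq ℝ
  have h2 : ContDiffAt ℝ 2 (fun x : V => inner ℝ e x ^ 2) x :=
    (contDiffAt_const.inner ℝ contDiffAt_id).pow 2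
  exact ((h1.sub h2).pow n).add (h2.pow n)

theorem inv_sqrt_lpSumSq_eq (he : ‖e‖ = 1) (hn : n ≠ 0) {x : V} (hx : inner ℝ e x ≠ 0) :
    (√(lpSumSq n e x))⁻¹ = |inner ℝ e x|⁻¹ * (√((((√(‖x‖ ^ 2 - inner ℝ e x ^ 2) /
      |inner ℝ e x|) ^ 2) ^ n + 1) ^ (1 / n : ℝ)))⁻¹ := by
  have ha := norm_sq_sub_inner_sq_nonneg he x
  have ht : 0 < inner ℝ e x ^ 2 := by positivity
  rw [div_pow, Real.sq_sqrt ha, sq_abs, ← mul_inv, ← Real.sqrt_sq_eq_abs,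
    ← Real.sqrt_mul ht.le]
  congr 2
  rw [lpSumSq]
  have hq : 0 ≤ (‖x‖ ^ 2 - inner ℝ e x ^ 2) / inner ℝ e x ^ 2 := div_nonneg ha ht.le
  have h := Real.mul_rpow (pow_nonneg ht.le n)
    (add_nonneg (pow_nonneg hq n) zero_le_one) (z := (1 / n : ℝ))
  rw [pow_rpow_one_div ht.le hn, mul_add, mul_one, ← mul_pow, mul_div_cancel₀ _ ht.ne'] at h
  exact h

/-- The profile lies strictly below 1/s, so no correction c is needed. The gap is at most s^(-2n-1),
which makes the integral converge for n large compared with the dimension. -/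
theorem sq_pow_add_one_bounds (hn : n ≠ 0) {s : ℝ} (hs : 0 < s) :
    0 < s⁻¹ - (√(((s ^ 2) ^ n + 1) ^ (1 / n : ℝ)))⁻¹ ∧
      s⁻¹ - (√(((s ^ 2) ^ n + 1) ^ (1 / n : ℝ)))⁻¹ ≤ s⁻¹ ∧
      (s⁻¹ - (√(((s ^ 2) ^ n + 1) ^ (1 / n : ℝ)))⁻¹) * s ^ (2 * n + 1) ≤ 1 := by
  set L := ((s ^ 2) ^ n + 1) ^ (1 / n : ℝ) with hL
  have hLpow : L ^ n = (s ^ 2) ^ n + 1 := by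
    rw [hL, one_div, Real.rpow_inv_natCast_pow (by positivity) hn]
  have hLpos : 0 < L := Real.rpow_pos_of_pos (by positivity) _
  set m := √L with hm
  have hm0 : 0 < m := Real.sqrt_pos.2 hLpos
  have hm2 : m ^ 2 = L := Real.sq_sqrt hLpos.le
  have hmpow : m ^ (2 * n) = s ^ (2 * n) + 1 := by rw [pow_mul, hm2, hLpow, pow_mul]
  have hsm : s < m := by
    refine lt_of_pow_lt_pow_left₀ (2 * n) hm0.le ?_
    linarith
  have hinv : 0 < m⁻¹ := inv_pos.2 hm0
  refine ⟨sub_pos.2 (inv_strictAnti₀ hs hsm), by linarith, ?_⟩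
  obtain ⟨N, hN⟩ : ∃ N, 2 * n = N + 1 := ⟨2 * n - 1, by omega⟩
  -- Here m^(N+1) - s^(N+1) = 1 and m^N ≥ s^N.
  have h1 : (m - s) * s ^ N ≤ 1 := by
    have h2 : s ^ N ≤ m ^ N := pow_le_pow_left₀ hs.le hsm.le N
    have h3 : m ^ N * m = s ^ N * s + 1 := by rw [← pow_succ, ← pow_succ, ← hN, hmpow]
    nlinarith
  have h4 : (s⁻¹ - m⁻¹) * s ^ (2 * n + 1) = ((m - s) * s ^ N) * (s / m) := by
    rw [hN, pow_succ, pow_succ]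
    field_simp
  rw [h4]
  have h5 : s / m ≤ 1 := (div_le_one hm0).2 hsm.le
  exact mul_le_one₀ h1 (by positivity) h5

theorem lpSum_integrand_eq (j : ℕ) {n : ℕ} {s : ℝ} (hs : 0 < s) :
    s ^ (j + 3) * (√(((s ^ 2) ^ n + 1) ^ (1 / n : ℝ)))⁻¹ - s ^ (j + 2) - 0 * s ^ j =
      -(s ^ (j + 3) * (s⁻¹ - (√(((s ^ 2) ^ n + 1) ^ (1 / n : ℝ)))⁻¹)) := by
  rw [mul_sub, pow_succ s (j + 2), mul_assoc _ s s⁻¹, mul_inv_cancel₀ hs.ne']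
  ring

theorem integrableOn_lpSum_integrand {j n : ℕ} (hn : j + 4 ≤ 2 * n) :
    IntegrableOn (fun s : ℝ => s ^ (j + 3) * (√(((s ^ 2) ^ n + 1) ^ (1 / n : ℝ)))⁻¹
      - s ^ (j + 2) - 0 * s ^ j) (Set.Ioi 0) := by
  refine Integrable.mono' (integrable_inv_one_add_sq.const_mul 2).integrableOn ?_ ?_
  · exact Measurable.aestronglyMeasurable (by fun_prop)
  refine (ae_restrict_iff' measurableSet_Ioi).2 (Filter.Eventually.of_forall fun s hs => ?_)
  have hs : 0 < s := hs
  obtain ⟨h1, h2, h3⟩ := sq_pow_add_one_bounds (n := n) (by omega) hs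
  rw [lpSum_integrand_eq j hs, norm_neg, Real.norm_eq_abs, abs_of_pos (by positivity)]
  set d := s⁻¹ - (√(((s ^ 2) ^ n + 1) ^ (1 / n : ℝ)))⁻¹
  rcases le_or_gt s 1 with hs1 | hs1
  · have h4 : s ^ (j + 3) * d ≤ 1 := by
      calc s ^ (j + 3) * d ≤ s ^ (j + 3) * s⁻¹ := by gcongr
        _ = s ^ (j + 2) := by rw [pow_succ]; field_simp
        _ ≤ 1 := pow_le_one₀ hs.le hs1
    have h5 : (2 : ℝ)⁻¹ ≤ (1 + s ^ 2)⁻¹ := inv_anti₀ (by positivity) (by nlinarith)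
    linarith
  · have h4 : s ^ (j + 3) * d * s ^ 2 ≤ 1 := by
      calc s ^ (j + 3) * d * s ^ 2 = d * s ^ (j + 5) := by ring
        _ ≤ d * s ^ (2 * n + 1) := by
          refine mul_le_mul_of_nonneg_left (pow_le_pow_right₀ hs1.le (by omega)) h1.le
        _ ≤ 1 := h3
    rw [← div_eq_mul_inv, le_div_iff₀ (by positivity)]
    have : s ^ (j + 3) * d ≤ s ^ (j + 3) * d * s ^ 2 :=
      le_mul_of_one_le_right (by positivity) (by nlinarith)
    linarith

theorem integral_lpSum_integrand_neg {j n : ℕ} (hn : j + 4 ≤ 2 * n) :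
    ∫ s in Set.Ioi (0 : ℝ), (s ^ (j + 3) * (√(((s ^ 2) ^ n + 1) ^ (1 / n : ℝ)))⁻¹
      - s ^ (j + 2) - 0 * s ^ j) < 0 := by
  rw [← neg_pos, ← integral_neg, integral_pos_iff_support_of_nonneg_ae]
  · have : Set.Ioi (0 : ℝ) ⊆ Function.support (fun s : ℝ =>
        -(s ^ (j + 3) * (√(((s ^ 2) ^ n + 1) ^ (1 / n : ℝ)))⁻¹ - s ^ (j + 2) - 0 * s ^ j)) := by
      intro s hs
      have hs : 0 < s := hs
      have := (sq_pow_add_one_bounds (n := n) (by omega) hs).1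
      rw [Function.mem_support, lpSum_integrand_eq j hs, neg_neg]
      exact (mul_pos (pow_pos hs _) this).ne'
    rw [Measure.restrict_apply₀' measurableSet_Ioi.nullMeasurableSet, Set.inter_eq_right.2 this]
    simp
  · refine (ae_restrict_iff' measurableSet_Ioi).2 (Filter.Eventually.of_forall fun s hs => ?_)
    have hs : 0 < s := hs
    have := (sq_pow_add_one_bounds (n := n) (by omega) hs).1
    beta_reduce
    rw [lpSum_integrand_eq j hs, neg_neg, Pi.zero_apply]
    positivity
  · exact (integrableOn_lpSum_integrand hn).neg

variable [FiniteDimensional ℝ V] [MeasurableSpace V] [BorelSpace V]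

/-- The term τ‖x‖² supplies the uniform convexity that the ℓ^(2n)-sum lacks. It only decreases the
radial function, so the case τ = 0 dominates and the strict inequality survives for small τ. -/
theorem exists_integral_sphere_lpSum_neg {j : ℕ} (hd : Module.finrank ℝ V = j + 5) (he : ‖e‖ = 1)
    (hn : j + 4 ≤ 2 * n) :
    ∃ δ : ℝ, 0 < δ ∧ δ ≤ 1 ∧ ∃ τ : ℝ, 0 < τ ∧
      ∫ θ : sphere (0 : V) 1, (√(lpSumSq n e (θ : V) + τ * ‖(θ : V)‖ ^ 2))⁻¹ *
        testRay (j + 3) δ e (θ : V) ∂(volume : Measure V).toSphere < 0 := by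
  have hn0 : n ≠ 0 := by omega
  have hmeas : AEStronglyMeasurable (fun x : V => (√(lpSumSq n e x))⁻¹) volume := by
    refine Measurable.aestronglyMeasurable ?_
    unfold lpSumSq
    fun_prop
  have hbound : ∀ x : V, |(√(lpSumSq n e x))⁻¹| ≤ 2 * ‖x‖⁻¹ := by
    intro x
    rw [abs_of_nonneg (inv_nonneg.2 (Real.sqrt_nonneg _))]
    rcases eq_or_ne x 0 with rfl | hx
    · simp [lpSumSq, hn0]
    have hx0 : 0 < ‖x‖ := norm_pos_iff.2 hx
    have h1 : ‖x‖ / 2 ≤ √(lpSumSq n e x) := by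
      refine Real.le_sqrt_of_sq_le ?_
      nlinarith [half_norm_sq_le_lpSumSq he hn0 x]
    calc _ ≤ (‖x‖ / 2)⁻¹ := inv_anti₀ (by positivity) h1
      _ = _ := by field_simp
  have hhom : ∀ (r : ℝ) (x : V), 0 < r →
      (√(lpSumSq n e (r • x)))⁻¹ = r⁻¹ * (√(lpSumSq n e x))⁻¹ := by
    intro r x hr
    rw [lpSumSq_smul he hn0, Real.sqrt_mul (sq_nonneg r), Real.sqrt_sq hr.le, mul_inv]
  obtain ⟨δ, hδ0, hδ1, hneg⟩ := exists_integral_mul_testFun_neg hd he hmeas hbound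
    (b := fun s => (√(((s ^ 2) ^ n + 1) ^ (1 / n : ℝ)))⁻¹) (c := 0)
    (fun x hx => inv_sqrt_lpSumSq_eq he hn0 hx) (integrableOn_lpSum_integrand hn)
    (integral_lpSum_integrand_neg hn)
  refine ⟨δ, hδ0, hδ1, ?_⟩
  rw [integral_mul_testFun_eq_sphere (k := j + 3) hd hδ0 hδ1 he.le hmeas hbound hhom] at hneg
  have hθ : ∀ θ : sphere (0 : V) 1, (θ : V) ≠ 0 := fun θ => ne_zero_of_mem_unit_sphere θ
  have hcf : Continuous fun θ : sphere (0 : V) 1 => testRay (j + 3) δ e (θ : V) :=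
    (continuousOn_testRay (j + 3) hδ0 hδ1 e).comp_continuous continuous_subtype_val hθ
  have hcl : Continuous fun θ : sphere (0 : V) 1 => lpSumSq n e (θ : V) :=
    continuous_iff_continuousAt.2 fun θ => ContinuousAt.comp (f := fun θ : sphere (0 : V) 1 =>
      (θ : V)) (contDiffAt_lpSumSq he (hθ θ)).continuousAt continuous_subtype_val.continuousAt
  have hcr : ∀ τ : ℝ, 0 ≤ τ → Continuous fun θ : sphere (0 : V) 1 =>
      (√(lpSumSq n e (θ : V) + τ * ‖(θ : V)‖ ^ 2))⁻¹ * testRay (j + 3) δ e (θ : V) := by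
    intro τ hτ
    refine Continuous.mul (Continuous.inv₀ (by fun_prop) fun θ => ?_) hcf
    have := lpSumSq_pos he hn0 (hθ θ)
    positivity
  have hlim : Filter.Tendsto (fun τ : ℝ => ∫ θ : sphere (0 : V) 1,
      (√(lpSumSq n e (θ : V) + τ * ‖(θ : V)‖ ^ 2))⁻¹ * testRay (j + 3) δ e (θ : V)
        ∂(volume : Measure V).toSphere) (nhdsWithin 0 (Set.Ioi 0))
      (nhds (∫ θ : sphere (0 : V) 1, (√(lpSumSq n e (θ : V)))⁻¹ * testRay (j + 3) δ e (θ : V)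
        ∂(volume : Measure V).toSphere)) := by
    refine tendsto_integral_filter_of_dominated_convergence
      (fun θ => |(√(lpSumSq n e (θ : V)))⁻¹ * testRay (j + 3) δ e (θ : V)|) ?_ ?_ ?_ ?_
    · filter_upwards [self_mem_nhdsWithin] with τ hτ
      exact (hcr τ (le_of_lt hτ)).aestronglyMeasurable
    · filter_upwards [self_mem_nhdsWithin] with τ hτ
      refine Filter.Eventually.of_forall fun θ => ?_
      have hτ : 0 < τ := hτ
      have := lpSumSq_pos he hn0 (hθ θ)
      rw [Real.norm_eq_abs, abs_mul, abs_mul, abs_of_pos (by positivity),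
        abs_of_pos (a := (√(lpSumSq n e (θ : V)))⁻¹) (by positivity)]
      gcongr
      exact le_add_of_nonneg_right (by positivity)
    · have hc0 := (hcr 0 le_rfl).abs
      simp only [zero_mul, add_zero] at hc0
      exact hc0.integrable_of_hasCompactSupport (HasCompactSupport.of_compactSpace _)
    · refine Filter.Eventually.of_forall fun θ => ?_
      have hpos := lpSumSq_pos he hn0 (hθ θ)
      have hc : ContinuousAt (fun τ : ℝ => (√(lpSumSq n e (θ : V) + τ * ‖(θ : V)‖ ^ 2))⁻¹ *
          testRay (j + 3) δ e (θ : V)) 0 := by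
        refine ContinuousAt.mul (ContinuousAt.inv₀ (by fun_prop) ?_) continuousAt_const
        simp only [zero_mul, add_zero]
        positivity
      have := hc.tendsto.mono_left (nhdsWithin_le_nhds (s := Set.Ioi 0))
      simpa using this
  obtain ⟨τ, h1, h2⟩ := ((hlim.eventually_lt_const hneg).and self_mem_nhdsWithin).exists
  exact ⟨τ, h2, h1⟩

end LpSum

/-! ### Volume of a body from its squared gauge. -/

section Sublevel

variable {V : Type*} [NormedAddCommGroup V] [InnerProductSpace ℝ V] [FiniteDimensional ℝ V]

theorem isCompact_sublevel_of_homogeneous [Nontrivial V] {Q : V → ℝ} (hc : Continuous Q)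
    (hhom : ∀ (r : ℝ) (x : V), Q (r • x) = r ^ 2 * Q x) (hpos : ∀ x, x ≠ 0 → 0 < Q x) :
    IsCompact {x | Q x ≤ 1} := by
  obtain ⟨u, hu, hmin⟩ := (isCompact_sphere (0 : V) 1).exists_isMinOn
    (NormedSpace.sphere_nonempty.2 zero_le_one) hc.continuousOn
  have hu0 : u ≠ 0 := ne_zero_of_mem_unit_sphere ⟨u, hu⟩
  have hm := hpos u hu0
  refine isCompact_of_isClosed_isBounded (isClosed_le hc continuous_const) ?_
  refine isBounded_iff_forall_norm_le.2 ⟨(√(Q u))⁻¹, fun x hx => ?_⟩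
  rcases eq_or_ne x 0 with rfl | hx0
  · simp
  have hxn : 0 < ‖x‖ := norm_pos_iff.2 hx0
  have h1 : Q u ≤ Q (‖x‖⁻¹ • x) := hmin (by
    rw [mem_sphere_zero_iff_norm, norm_smul, norm_inv, norm_norm, inv_mul_cancel₀ hxn.ne'])
  have hx1 : Q x ≤ 1 := hx
  have h2 : ‖x‖ ^ 2 * Q u ≤ 1 := by
    rw [hhom, inv_pow, ← div_eq_inv_mul, le_div_iff₀ (by positivity)] at h1
    linarith
  rw [le_inv_comm₀ hxn (Real.sqrt_pos.2 hm), Real.sqrt_le_left (by positivity), inv_pow,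
    ← one_div, le_div_iff₀ (by positivity), mul_comm]
  exact h2

variable [MeasurableSpace V] [BorelSpace V]

theorem measureReal_sublevel_of_homogeneous {m : ℕ} (hd : Module.finrank ℝ V = m + 1)
    {Q : V → ℝ} (hc : Continuous Q) (hhom : ∀ (r : ℝ) (x : V), Q (r • x) = r ^ 2 * Q x)
    (hpos : ∀ x, x ≠ 0 → 0 < Q x) :
    volume.real {x | Q x ≤ 1} = ∫ θ : sphere (0 : V) 1, (√(Q (θ : V)))⁻¹ ^ (m + 1) / (m + 1 : ℕ)
      ∂(volume : Measure V).toSphere := by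
  have : Nontrivial V := Module.nontrivial_of_finrank_pos (R := ℝ) (by omega)
  have hcomp := isCompact_sublevel_of_homogeneous hc hhom hpos
  have hmeas : MeasurableSet {x | Q x ≤ 1} := hcomp.measurableSet
  have hint : Integrable ({x | Q x ≤ 1}.indicator (1 : V → ℝ)) :=
    (integrable_indicator_iff hmeas).2 (integrableOn_const hcomp.measure_lt_top.ne)
  rw [← integral_indicator_one hmeas, integral_eq_integral_sphere volume hint]
  refine integral_congr_ae (Filter.Eventually.of_forall fun θ => ?_)
  have hθ := hpos (θ : V) (ne_zero_of_mem_unit_sphere θ)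
  have hR : 0 < (√(Q (θ : V)))⁻¹ := inv_pos.2 (Real.sqrt_pos.2 hθ)
  have hmem : ∀ r : ℝ, 0 < r → (Q (r • (θ : V)) ≤ 1 ↔ r ≤ (√(Q (θ : V)))⁻¹) := by
    intro r hr
    rw [hhom, le_inv_comm₀ hr (Real.sqrt_pos.2 hθ), Real.sqrt_le_left (by positivity), inv_pow,
      ← one_div, le_div_iff₀ (by positivity), mul_comm]
  have hset : ∀ r ∈ Set.Ioi (0 : ℝ), r ^ (Module.finrank ℝ V - 1) *
      ({x | Q x ≤ 1}.indicator (1 : V → ℝ)) (r • (θ : V)) =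
      (Set.Iic (√(Q (θ : V)))⁻¹).indicator (fun r : ℝ => r ^ m) r := by
    intro r hr
    rw [hd, Nat.add_sub_cancel]
    by_cases h : r ≤ (√(Q (θ : V)))⁻¹
    · rw [Set.indicator_of_mem (by exact (hmem r hr).2 h), Set.indicator_of_mem (by exact h)]
      simp
    · rw [Set.indicator_of_notMem (by exact fun h' => h ((hmem r hr).1 h')),
        Set.indicator_of_notMem (by exact h), mul_zero]
  beta_reduce
  rw [setIntegral_congr_fun measurableSet_Ioi hset, setIntegral_indicator measurableSet_Iic,
    Set.Ioi_inter_Iic, ← intervalIntegral.integral_of_le hR.le, integral_pow]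
  simp

theorem integrable_sphere_of_continuousOn {f : V → ℝ} (hf : ContinuousOn f {0}ᶜ) :
    Integrable (fun θ : sphere (0 : V) 1 => f θ) (volume : Measure V).toSphere :=
  (hf.comp_continuous continuous_subtype_val
    fun θ => ne_zero_of_mem_unit_sphere θ).integrable_of_hasCompactSupport
    (HasCompactSupport.of_compactSpace _)

end Sublevel

/-! ### The perturbed body: homogeneity, regularity, convexity. -/

section Perturbation

variable {V : Type*} [NormedAddCommGroup V] [InnerProductSpace ℝ V]

/-- The `(k + 1)`-st power of the radial function of the perturbed body. -/
noncomputable def perturbedPower (k n : ℕ) (δ τ η : ℝ) (e x : V) : ℝ :=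
  (lpSumSq n e x + τ * ‖x‖ ^ 2) ^ (-((k : ℝ) + 1) / 2) - η * testRay k δ e x

/-- The square of the gauge of the perturbed body. -/
noncomputable def perturbedGaugeSq (k n : ℕ) (δ τ η : ℝ) (e x : V) : ℝ :=
  perturbedPower k n δ τ η e x ^ (-2 / ((k : ℝ) + 1))

variable {k n : ℕ} {δ τ : ℝ} {e : V}

theorem testRay_smul (hδ0 : 0 < δ) (hδ : δ ≤ 1) {r : ℝ} (hr : r ≠ 0) (x : V) :
    testRay k δ e (r • x) = (r ^ 2) ^ (-((k : ℝ) + 1) / 2) * testRay k δ e x := by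
  have hw : 0 ≤ spheroidForm δ e x := (by positivity : 0 ≤ δ * ‖x‖ ^ 2).trans
    (le_spheroidForm hδ e x)
  rw [testRay, testRay, spheroidForm_smul, inner_smul_right, Real.mul_rpow (sq_nonneg r) hw,
    mul_pow, mul_div_mul_left _ _ (by positivity)]
  ring

theorem lpSumSq_add_pos (he : ‖e‖ = 1) (hn : n ≠ 0) (hτ : 0 < τ) {x : V} (hx : x ≠ 0) :
    0 < lpSumSq n e x + τ * ‖x‖ ^ 2 := by
  have := lpSumSq_pos he hn hx
  positivity

theorem lpSumSq_add_nonneg (he : ‖e‖ = 1) (n : ℕ) (hτ : 0 < τ) (x : V) :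
    0 ≤ lpSumSq n e x + τ * ‖x‖ ^ 2 := by
  have := lpSumSq_nonneg he n x
  positivity

theorem perturbedPower_smul (he : ‖e‖ = 1) (hn : n ≠ 0) (hδ0 : 0 < δ) (hδ : δ ≤ 1) (hτ : 0 < τ)
    (η : ℝ) {r : ℝ} (hr : r ≠ 0) (x : V) :
    perturbedPower k n δ τ η e (r • x) =
      (r ^ 2) ^ (-((k : ℝ) + 1) / 2) * perturbedPower k n δ τ η e x := by
  have h : lpSumSq n e (r • x) + τ * ‖r • x‖ ^ 2 = r ^ 2 * (lpSumSq n e x + τ * ‖x‖ ^ 2) := by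
    rw [lpSumSq_smul he hn, norm_smul, mul_pow, Real.norm_eq_abs, sq_abs]
    ring
  rw [perturbedPower, perturbedPower, h, testRay_smul hδ0 hδ hr,
    Real.mul_rpow (sq_nonneg r) (lpSumSq_add_nonneg he n hτ x)]
  ring

theorem rpow_rpow_gauge {a : ℝ} (ha : 0 ≤ a) (k : ℕ) :
    (a ^ (-((k : ℝ) + 1) / 2)) ^ (-2 / ((k : ℝ) + 1)) = a := by
  rw [← Real.rpow_mul ha]
  have : -((k : ℝ) + 1) / 2 * (-2 / ((k : ℝ) + 1)) = 1 := by field_simp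
  rw [this, Real.rpow_one]

theorem perturbedGaugeSq_zero_param (he : ‖e‖ = 1) (hτ : 0 < τ) (x : V) :
    perturbedGaugeSq k n δ τ 0 e x = lpSumSq n e x + τ * ‖x‖ ^ 2 := by
  rw [perturbedGaugeSq, perturbedPower, zero_mul, sub_zero,
    rpow_rpow_gauge (lpSumSq_add_nonneg he n hτ x)]

theorem perturbedGaugeSq_zero (hn : n ≠ 0) (η : ℝ) :
    perturbedGaugeSq k n δ τ η e (0 : V) = 0 := by
  have h1 : -((k : ℝ) + 1) / 2 ≠ 0 := by
    have : (0 : ℝ) < (k : ℝ) + 1 := by positivity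
    exact div_ne_zero (by linarith) two_ne_zero
  have h2 : -2 / ((k : ℝ) + 1) ≠ 0 := div_ne_zero (by norm_num) (by positivity)
  have h3 : lpSumSq n e (0 : V) = 0 := by simp [lpSumSq, hn]
  have h4 : spheroidForm δ e (0 : V) = 0 := by simp [spheroidForm]
  -- The value at the origin rests on the convention that 0 to any non-zero real power, even a
  -- negative one, is 0.
  rw [perturbedGaugeSq, perturbedPower, testRay, h3, h4, norm_zero, zero_pow two_ne_zero,
    mul_zero, add_zero, Real.zero_rpow h1, mul_zero, zero_mul, mul_zero, sub_zero,
    Real.zero_rpow h2]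

theorem perturbedGaugeSq_smul (he : ‖e‖ = 1) (hn : n ≠ 0) (hδ0 : 0 < δ) (hδ : δ ≤ 1) (hτ : 0 < τ)
    {η : ℝ} (hpos : ∀ x : V, x ≠ 0 → 0 < perturbedPower k n δ τ η e x) (r : ℝ) (x : V) :
    perturbedGaugeSq k n δ τ η e (r • x) = r ^ 2 * perturbedGaugeSq k n δ τ η e x := by
  rcases eq_or_ne r 0 with rfl | hr
  · rw [zero_smul, perturbedGaugeSq_zero hn]; ring
  rcases eq_or_ne x 0 with rfl | hx
  · rw [smul_zero, perturbedGaugeSq_zero hn]; ring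
  rw [perturbedGaugeSq, perturbedPower_smul he hn hδ0 hδ hτ η hr, Real.mul_rpow
    (Real.rpow_nonneg (sq_nonneg r) _) (hpos x hx).le, rpow_rpow_gauge (sq_nonneg r)]
  rfl

theorem contDiffAt_spheroidForm (δ : ℝ) (e x : V) : ContDiffAt ℝ 2 (spheroidForm δ e) x := by
  have h1 : ContDiffAt ℝ 2 (fun x : V => ‖x‖ ^ 2) x := contDiffAt_id.norm_sq ℝ
  have h2 : ContDiffAt ℝ 2 (fun x : V => inner ℝ e x ^ 2) x :=
    (contDiffAt_const.inner ℝ contDiffAt_id).pow 2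
  unfold spheroidForm
  exact h2.add (contDiffAt_const.mul (h1.sub h2))

theorem contDiffAt_testRay (k : ℕ) (hδ0 : 0 < δ) (hδ : δ ≤ 1) (e : V) {x : V} (hx : x ≠ 0) :
    ContDiffAt ℝ 2 (testRay k δ e) x := by
  have h2 : ContDiffAt ℝ 2 (fun x : V => inner ℝ e x ^ 2) x :=
    (contDiffAt_const.inner ℝ contDiffAt_id).pow 2
  have hw := contDiffAt_spheroidForm δ e x
  have hw0 := (spheroidForm_pos hδ0 hδ e hx).ne'
  have hq : ContDiffAt ℝ 2 (fun x : V => inner ℝ e x ^ 2 / spheroidForm δ e x) x := h2.div hw hw0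
  unfold testRay
  exact (contDiffAt_const.mul (hw.rpow_const_of_ne hw0)).mul
    (((contDiffAt_const.mul (hq.pow 2)).sub (contDiffAt_const.mul hq)).add contDiffAt_const)

theorem contDiffAt_lpSumSq_add (he : ‖e‖ = 1) {x : V} (hx : x ≠ 0) :
    ContDiffAt ℝ 2 (fun x => lpSumSq n e x + τ * ‖x‖ ^ 2) x :=
  (contDiffAt_lpSumSq he hx).add (contDiffAt_const.mul (contDiffAt_id.norm_sq ℝ))

theorem contDiffAt_perturbedPower (he : ‖e‖ = 1) (hn : n ≠ 0) (hδ0 : 0 < δ) (hδ : δ ≤ 1)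
    (hτ : 0 < τ) (η : ℝ) {x : V} (hx : x ≠ 0) :
    ContDiffAt ℝ 2 (fun p : ℝ × V => perturbedPower k n δ τ p.1 e p.2) (η, x) := by
  have hM : ContDiffAt ℝ 2
      (fun x => (lpSumSq n e x + τ * ‖x‖ ^ 2) ^ (-((k : ℝ) + 1) / 2)) x :=
    (contDiffAt_lpSumSq_add he hx).rpow_const_of_ne (lpSumSq_add_pos he hn hτ hx).ne'
  unfold perturbedPower
  exact (ContDiffAt.comp (η, x) (f := Prod.snd) hM contDiffAt_snd).sub (contDiffAt_fst.mul
    (ContDiffAt.comp (η, x) (f := Prod.snd) (contDiffAt_testRay k hδ0 hδ e hx) contDiffAt_snd))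

theorem perturbedPower_zero_param_pos (he : ‖e‖ = 1) (hn : n ≠ 0) (hτ : 0 < τ) {x : V}
    (hx : x ≠ 0) : 0 < perturbedPower k n δ τ 0 e x := by
  rw [perturbedPower, zero_mul, sub_zero]
  exact Real.rpow_pos_of_pos (lpSumSq_add_pos he hn hτ hx) _

variable [FiniteDimensional ℝ V]

theorem eventually_perturbedPower_pos (he : ‖e‖ = 1) (hn : n ≠ 0) (hδ0 : 0 < δ) (hδ : δ ≤ 1)
    (hτ : 0 < τ) :
    ∀ᶠ η in nhds (0 : ℝ), ∀ x : V, x ≠ 0 → 0 < perturbedPower k n δ τ η e x := by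
  have htube := (isCompact_sphere (0 : V) 1).eventually_forall_of_forall_eventually (x₀ := (0 : ℝ))
    (P := fun η x => 0 < perturbedPower k n δ τ η e x) (fun x hx => by
      have hx0 : x ≠ 0 := ne_zero_of_mem_unit_sphere ⟨x, hx⟩
      exact (contDiffAt_perturbedPower he hn hδ0 hδ hτ 0 hx0).continuousAt.eventually_const_lt
        (perturbedPower_zero_param_pos he hn hτ hx0))
  filter_upwards [htube] with η hη x hx
  have hxn : 0 < ‖x‖ := norm_pos_iff.2 hx
  have h := hη (‖x‖⁻¹ • x) (by
    rw [mem_sphere_zero_iff_norm, norm_smul, norm_inv, norm_norm, inv_mul_cancel₀ hxn.ne'])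
  rw [perturbedPower_smul he hn hδ0 hδ hτ η (inv_pos.2 hxn).ne'] at h
  exact pos_of_mul_pos_right h (Real.rpow_nonneg (sq_nonneg _) _)

/-- Subtracting `lpSumSq` leaves a family equal to τ‖x‖² at η = 0, to which the stability result
applies; adding the convex `lpSumSq` back preserves convexity. -/
theorem eventually_convexOn_perturbedGaugeSq (he : ‖e‖ = 1) (hn : n ≠ 0) (hδ0 : 0 < δ)
    (hδ : δ ≤ 1) (hτ : 0 < τ) :
    ∀ᶠ η in nhds (0 : ℝ), ConvexOn ℝ Set.univ (perturbedGaugeSq k n δ τ η e) := by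
  have h := eventually_convexOn_of_homogeneous_family (V := V)
    (T := fun p => perturbedGaugeSq k n δ τ p.1 e p.2 - lpSumSq n e p.2) (τ := τ) ?_ ?_ hτ ?_
  · filter_upwards [h] with η hη
    refine (hη.add (convexOn_lpSumSq he hn)).congr fun x _ => ?_
    simp
  · filter_upwards [eventually_perturbedPower_pos he hn hδ0 hδ hτ] with η hη r x
    rw [perturbedGaugeSq_smul he hn hδ0 hδ hτ hη, lpSumSq_smul he hn]
    ring
  · intro u hu
    have hu0 : u ≠ 0 := by rintro rfl; simp at hu
    refine ContDiffAt.sub ?_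
      (ContDiffAt.comp ((0 : ℝ), u) (f := Prod.snd) (contDiffAt_lpSumSq he hu0) contDiffAt_snd)
    unfold perturbedGaugeSq
    exact (contDiffAt_perturbedPower he hn hδ0 hδ hτ 0 hu0).rpow_const_of_ne
      (perturbedPower_zero_param_pos he hn hτ hu0).ne'
  · intro x
    rw [perturbedGaugeSq_zero_param he hτ]
    ring

end Perturbation

/-! ### Comparison of sections and volumes; the Busemann-Petty counterexample. -/

section Comparison

theorem inv_sqrt_rpow_pow {g : ℝ} (hg : 0 < g) (k j : ℕ) :
    (√(g ^ (-2 / ((k : ℝ) + 1))))⁻¹ ^ j = g ^ ((j : ℝ) / ((k : ℝ) + 1)) := by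
  rw [Real.sqrt_eq_rpow, ← Real.rpow_mul hg.le, ← Real.rpow_neg hg.le, ← Real.rpow_natCast,
    ← Real.rpow_mul hg.le]
  congr 1
  field_simp

/-- The tangent-line bound for the convex function x^p at g. It holds without an error term in η, so
no second-order estimate is needed. -/
theorem bernoulli_perturbation {g f η p : ℝ} (hg : 0 < g) (hpos : 0 < g - η * f) (hp : 1 ≤ p) :
    g ^ p - p * η * (g ^ (p - 1) * f) ≤ (g - η * f) ^ p := by
  have h1 : g - η * f = g * (1 + -(η * f / g)) := by field_simp; ring
  have hs : 0 < 1 + -(η * f / g) := by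
    rw [h1] at hpos
    exact pos_of_mul_pos_right hpos hg.le
  have h2 := one_add_mul_self_le_rpow_one_add (s := -(η * f / g)) (by linarith) hp
  rw [h1, Real.mul_rpow hg.le hs.le]
  calc g ^ p - p * η * (g ^ (p - 1) * f) = g ^ p * (1 + p * -(η * f / g)) := by
        rw [Real.rpow_sub_one hg.ne']
        ring
    _ ≤ _ := mul_le_mul_of_nonneg_left h2 (Real.rpow_nonneg hg.le p)

variable {k n : ℕ} {δ τ η : ℝ} {e : E (k + 2)}

theorem isConvexBody_perturbed (he : ‖e‖ = 1) (hn : n ≠ 0) (hδ0 : 0 < δ) (hδ : δ ≤ 1)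
    (hτ : 0 < τ) (hpos : ∀ x : E (k + 2), x ≠ 0 → 0 < perturbedPower k n δ τ η e x)
    (hconv : ConvexOn ℝ Set.univ (perturbedGaugeSq k n δ τ η e)) :
    IsConvexBody {x | perturbedGaugeSq k n δ τ η e x ≤ 1} ∧
      IsOriginSymmetric {x | perturbedGaugeSq k n δ τ η e x ≤ 1} := by
  have hhom := perturbedGaugeSq_smul he hn hδ0 hδ hτ hpos
  have hc : Continuous (perturbedGaugeSq k n δ τ η e) :=
    continuousOn_univ.1 (hconv.continuousOn isOpen_univ)
  have : Nontrivial (E (k + 2)) := Module.nontrivial_of_finrank_pos (R := ℝ) (by simp)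
  refine ⟨⟨?_, isCompact_sublevel_of_homogeneous hc hhom
    fun x hx => Real.rpow_pos_of_pos (hpos x hx) _, ?_⟩, fun x hx => ?_⟩
  · simpa using hconv.convex_le 1
  · refine ⟨0, mem_interior.2 ⟨{x | perturbedGaugeSq k n δ τ η e x < 1}, fun x hx => ?_,
      isOpen_lt hc continuous_const, ?_⟩⟩
    · exact le_of_lt (show perturbedGaugeSq k n δ τ η e x < 1 from hx)
    · show perturbedGaugeSq k n δ τ η e 0 < 1
      rw [perturbedGaugeSq_zero hn]
      exact one_pos
  · have h := hhom (-1) x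
    rw [neg_one_smul] at h
    show perturbedGaugeSq k n δ τ η e (-x) ≤ 1
    rw [h]
    simpa using hx

/-- The section volume is linear in ρ^(k+1), which is `perturbedPower`; this is why the perturbation
is made at the level of that power. -/
theorem volume_section_perturbed (he : ‖e‖ = 1) (hn : n ≠ 0) (hδ0 : 0 < δ) (hδ : δ ≤ 1)
    (hτ : 0 < τ) (hpos : ∀ x : E (k + 2), x ≠ 0 → 0 < perturbedPower k n δ τ η e x)
    (hconv : ConvexOn ℝ Set.univ (perturbedGaugeSq k n δ τ η e)) {ξ : E (k + 2)} (hξ : ξ ≠ 0) :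
    volume {x : hyperplane ξ | (x : E (k + 2)) ∈ {x | perturbedGaugeSq k n δ τ η e x ≤ 1}} =
      ENNReal.ofReal (∫ θ : sphere (0 : hyperplane ξ) 1,
        perturbedPower k n δ τ η e ((θ : hyperplane ξ) : E (k + 2)) / (k + 1 : ℕ)
          ∂(volume : Measure (hyperplane ξ)).toSphere) := by
  have hhom := perturbedGaugeSq_smul he hn hδ0 hδ hτ hpos
  have hc : Continuous (perturbedGaugeSq k n δ τ η e) :=
    continuousOn_univ.1 (hconv.continuousOn isOpen_univ)
  have hfin := finrank_hyperplane hξ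
  have : Nontrivial (hyperplane ξ) :=
    Module.nontrivial_of_finrank_pos (R := ℝ) (by rw [hfin]; exact Nat.succ_pos k)
  have hc' : Continuous fun x : hyperplane ξ => perturbedGaugeSq k n δ τ η e (x : E (k + 2)) :=
    hc.comp continuous_subtype_val
  have hhom' : ∀ (r : ℝ) (x : hyperplane ξ), perturbedGaugeSq k n δ τ η e
      ((r • x : hyperplane ξ) : E (k + 2)) =
      r ^ 2 * perturbedGaugeSq k n δ τ η e (x : E (k + 2)) := fun r x => hhom r x
  have hpos' : ∀ x : hyperplane ξ, x ≠ 0 →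
      0 < perturbedGaugeSq k n δ τ η e (x : E (k + 2)) := fun x hx =>
    Real.rpow_pos_of_pos (hpos _ (by simpa using hx)) _
  have h := measureReal_sublevel_of_homogeneous hfin hc' hhom' hpos'
  have hfinite := (isCompact_sublevel_of_homogeneous hc' hhom' hpos').measure_lt_top (μ := volume)
  rw [Measure.real] at h
  have h2 := ENNReal.ofReal_toReal hfinite.ne
  rw [h] at h2
  refine h2.symm.trans ?_
  congr 1
  refine integral_congr_ae (Filter.Eventually.of_forall fun θ => ?_)
  have hθ : ((θ : hyperplane ξ) : E (k + 2)) ≠ 0 := by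
    simpa using ne_zero_of_mem_unit_sphere θ
  beta_reduce
  rw [perturbedGaugeSq, inv_sqrt_rpow_pow (hpos _ hθ)]
  push_cast
  rw [div_self (by positivity), Real.rpow_one]

theorem volume_perturbed (he : ‖e‖ = 1) (hn : n ≠ 0) (hδ0 : 0 < δ) (hδ : δ ≤ 1)
    (hτ : 0 < τ) (hpos : ∀ x : E (k + 2), x ≠ 0 → 0 < perturbedPower k n δ τ η e x)
    (hconv : ConvexOn ℝ Set.univ (perturbedGaugeSq k n δ τ η e)) :
    volume {x : E (k + 2) | perturbedGaugeSq k n δ τ η e x ≤ 1} =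
      ENNReal.ofReal (∫ θ : S (k + 2),
        perturbedPower k n δ τ η e (θ : E (k + 2)) ^ (((k : ℝ) + 2) / (k + 1)) / (k + 2 : ℕ)
          ∂(volume : Measure (E (k + 2))).toSphere) := by
  have hhom := perturbedGaugeSq_smul he hn hδ0 hδ hτ hpos
  have hc : Continuous (perturbedGaugeSq k n δ τ η e) :=
    continuousOn_univ.1 (hconv.continuousOn isOpen_univ)
  have : Nontrivial (E (k + 2)) := Module.nontrivial_of_finrank_pos (R := ℝ) (by simp)
  have hpos' : ∀ x : E (k + 2), x ≠ 0 → 0 < perturbedGaugeSq k n δ τ η e x := fun x hx =>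
    Real.rpow_pos_of_pos (hpos _ hx) _
  have h := measureReal_sublevel_of_homogeneous (m := k + 1) finrank_euclideanSpace_fin
    hc hhom hpos'
  have hfinite := (isCompact_sublevel_of_homogeneous hc hhom hpos').measure_lt_top (μ := volume)
  rw [Measure.real] at h
  have h2 := ENNReal.ofReal_toReal hfinite.ne
  rw [h] at h2
  refine h2.symm.trans ?_
  congr 1
  refine integral_congr_ae (Filter.Eventually.of_forall fun θ => ?_)
  have hθ : (θ : E (k + 2)) ≠ 0 := ne_zero_of_mem_unit_sphere θ
  beta_reduce
  rw [perturbedGaugeSq, inv_sqrt_rpow_pow (hpos _ hθ)]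
  push_cast
  ring_nf

theorem continuousOn_perturbedPower (he : ‖e‖ = 1) (hn : n ≠ 0) (hδ0 : 0 < δ) (hδ : δ ≤ 1)
    (hτ : 0 < τ) (η : ℝ) : ContinuousOn (perturbedPower k n δ τ η e) {0}ᶜ := fun x hx =>
  (ContinuousAt.comp (f := fun x : E (k + 2) => (η, x))
    (contDiffAt_perturbedPower he hn hδ0 hδ hτ η hx).continuousAt (by fun_prop)).continuousWithinAt

theorem volume_section_perturbed_le (he : ‖e‖ = 1) (hn : n ≠ 0) (hδ0 : 0 < δ) (hδ : δ ≤ 1)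
    (hτ : 0 < τ) (hη : 0 < η) {ξ : E (k + 2)} (hξ : ξ ≠ 0) :
    ∫ θ : sphere (0 : hyperplane ξ) 1,
        perturbedPower k n δ τ η e ((θ : hyperplane ξ) : E (k + 2)) / (k + 1 : ℕ)
          ∂(volume : Measure (hyperplane ξ)).toSphere ≤
      ∫ θ : sphere (0 : hyperplane ξ) 1,
        perturbedPower k n δ τ 0 e ((θ : hyperplane ξ) : E (k + 2)) / (k + 1 : ℕ)
          ∂(volume : Measure (hyperplane ξ)).toSphere := by
  rw [integral_div, integral_div]
  refine div_le_div_of_nonneg_right ?_ (Nat.cast_nonneg _)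
  have hf := integral_hyperplane_testRay_nonneg hδ0 hδ he.le hξ
  have hmaps : Set.MapsTo (fun x : hyperplane ξ => (x : E (k + 2))) {0}ᶜ {0}ᶜ := fun x hx => by
    simpa using hx
  have i1 := integrable_sphere_of_continuousOn (V := hyperplane ξ)
    ((continuousOn_perturbedPower (k := k) he hn hδ0 hδ hτ 0).comp
      continuous_subtype_val.continuousOn hmaps)
  have i2 := integrable_sphere_of_continuousOn (V := hyperplane ξ)
    ((continuousOn_testRay k hδ0 hδ e).comp continuous_subtype_val.continuousOn hmaps)
  have hsplit : ∀ x : E (k + 2), perturbedPower k n δ τ η e x =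
      perturbedPower k n δ τ 0 e x - η * testRay k δ e x := fun x => by
    simp only [perturbedPower]; ring
  simp only [hsplit]
  rw [integral_sub (by exact i1) (by exact i2.const_mul η), integral_const_mul]
  have := mul_nonneg hη.le hf
  linarith

theorem volume_lt_volume_perturbed (he : ‖e‖ = 1) (hn : n ≠ 0) (hδ0 : 0 < δ) (hδ : δ ≤ 1)
    (hτ : 0 < τ) (hη : 0 < η) (hpos : ∀ x : E (k + 2), x ≠ 0 → 0 < perturbedPower k n δ τ η e x)
    (hneg : ∫ θ : S (k + 2), (√(lpSumSq n e (θ : E (k + 2)) + τ * ‖(θ : E (k + 2))‖ ^ 2))⁻¹ *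
        testRay k δ e (θ : E (k + 2)) ∂(volume : Measure (E (k + 2))).toSphere < 0) :
    ∫ θ : S (k + 2),
        perturbedPower k n δ τ 0 e (θ : E (k + 2)) ^ (((k : ℝ) + 2) / (k + 1)) / (k + 2 : ℕ)
          ∂(volume : Measure (E (k + 2))).toSphere <
      ∫ θ : S (k + 2),
        perturbedPower k n δ τ η e (θ : E (k + 2)) ^ (((k : ℝ) + 2) / (k + 1)) / (k + 2 : ℕ)
          ∂(volume : Measure (E (k + 2))).toSphere := by
  rw [integral_div, integral_div]
  refine div_lt_div_of_pos_right ?_ (by positivity)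
  set p : ℝ := ((k : ℝ) + 2) / (k + 1) with hp
  have hp1 : 1 ≤ p := by rw [hp, le_div_iff₀ (by positivity)]; linarith
  -- As p - 1 = 1/(k + 1), this power recovers the unperturbed radial function, so the first-order
  -- term is the integral assumed negative.
  have hpow : ∀ x : E (k + 2), x ≠ 0 → perturbedPower k n δ τ 0 e x ^ (p - 1) =
      (√(lpSumSq n e x + τ * ‖x‖ ^ 2))⁻¹ := fun x hx => by
    have hM := lpSumSq_add_pos he hn hτ hx
    rw [perturbedPower, zero_mul, sub_zero, ← Real.rpow_mul hM.le, Real.sqrt_eq_rpow,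
      ← Real.rpow_neg hM.le]
    congr 1
    rw [hp]
    field_simp
    ring
  have hpos0 : ∀ x : E (k + 2), x ≠ 0 → 0 < perturbedPower k n δ τ 0 e x := fun x hx =>
    perturbedPower_zero_param_pos he hn hτ hx
  have c0 := continuousOn_perturbedPower (k := k) he hn hδ0 hδ hτ 0
  have c1 := continuousOn_perturbedPower (k := k) he hn hδ0 hδ hτ η
  have cf := continuousOn_testRay k hδ0 hδ e
  have i0 := integrable_sphere_of_continuousOn
    (c0.rpow_const (p := p) fun x hx => Or.inl (hpos0 x hx).ne')
  have i1 := integrable_sphere_of_continuousOn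
    (c1.rpow_const (p := p) fun x hx => Or.inl (hpos x hx).ne')
  have i2 := integrable_sphere_of_continuousOn
    ((c0.rpow_const (p := p - 1) fun x hx => Or.inl (hpos0 x hx).ne').mul cf)
  have hle : ∫ θ : S (k + 2), (perturbedPower k n δ τ 0 e (θ : E (k + 2)) ^ p - p * η *
      (perturbedPower k n δ τ 0 e (θ : E (k + 2)) ^ (p - 1) * testRay k δ e (θ : E (k + 2))))
        ∂(volume : Measure (E (k + 2))).toSphere ≤
      ∫ θ : S (k + 2), perturbedPower k n δ τ η e (θ : E (k + 2)) ^ p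
        ∂(volume : Measure (E (k + 2))).toSphere := by
    refine integral_mono (by exact i0.sub (i2.const_mul (p * η))) (by exact i1) fun θ => ?_
    have hθ : (θ : E (k + 2)) ≠ 0 := ne_zero_of_mem_unit_sphere θ
    have hsplit : perturbedPower k n δ τ η e (θ : E (k + 2)) =
        perturbedPower k n δ τ 0 e (θ : E (k + 2)) - η * testRay k δ e (θ : E (k + 2)) := by
      simp only [perturbedPower]; ring
    have h := hpos _ hθ
    rw [hsplit] at h
    beta_reduce
    rw [hsplit]
    exact bernoulli_perturbation (hpos0 _ hθ) h hp1
  refine lt_of_lt_of_le ?_ hle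
  rw [integral_sub (by exact i0) (by exact i2.const_mul (p * η)), integral_const_mul]
  have heq : ∫ θ : S (k + 2), perturbedPower k n δ τ 0 e (θ : E (k + 2)) ^ (p - 1) *
      testRay k δ e (θ : E (k + 2)) ∂(volume : Measure (E (k + 2))).toSphere =
      ∫ θ : S (k + 2), (√(lpSumSq n e (θ : E (k + 2)) + τ * ‖(θ : E (k + 2))‖ ^ 2))⁻¹ *
        testRay k δ e (θ : E (k + 2)) ∂(volume : Measure (E (k + 2))).toSphere :=
    integral_congr_ae (Filter.Eventually.of_forall fun θ => by
      beta_reduce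
      rw [hpow _ (ne_zero_of_mem_unit_sphere θ)])
  rw [heq]
  have : p * η * ∫ θ : S (k + 2), (√(lpSumSq n e (θ : E (k + 2)) + τ * ‖(θ : E (k + 2))‖ ^ 2))⁻¹ *
        testRay k δ e (θ : E (k + 2)) ∂(volume : Measure (E (k + 2))).toSphere < 0 :=
    mul_neg_of_pos_of_neg (by positivity) hneg
  linarith

theorem not_busemannPettyAffirmative {m : ℕ} (hm : 5 ≤ m) : ¬ BusemannPettyAffirmative m := by
  obtain ⟨j, rfl⟩ : ∃ j, m = j + 5 := ⟨m - 5, by omega⟩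
  have he : ‖axis (j + 4)‖ = 1 := norm_axis (j + 4)
  have hn : j + 4 ≠ 0 := by omega
  -- The exponent n = j + 4 is a convenient choice; only j + 4 ≤ 2n is required.
  obtain ⟨δ, hδ0, hδ1, τ, hτ, hneg⟩ := exists_integral_sphere_lpSum_neg (V := E (j + 5))
    (n := j + 4) finrank_euclideanSpace_fin he (by omega)
  have hev1 := eventually_perturbedPower_pos (k := j + 3) (V := E (j + 5)) he hn hδ0 hδ1 hτ
  have hev2 := eventually_convexOn_perturbedGaugeSq (k := j + 3) (V := E (j + 5)) he hn hδ0 hδ1 hτ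
  have hpos0 := hev1.self_of_nhds
  have hconv0 := hev2.self_of_nhds
  obtain ⟨η, ⟨hpos, hconv⟩, hη⟩ :=
    (((hev1.and hev2).filter_mono (nhdsWithin_le_nhds (s := Set.Ioi 0))).and
      self_mem_nhdsWithin).exists
  have hη : 0 < η := hη
  intro h
  have hK := isConvexBody_perturbed (k := j + 3) he hn hδ0 hδ1 hτ hpos hconv
  have hL := isConvexBody_perturbed (k := j + 3) he hn hδ0 hδ1 hτ hpos0 hconv0
  have hle := h _ _ hK.1 hK.2 hL.1 hL.2 fun ξ hξ => by
    rw [volume_section_perturbed (k := j + 3) he hn hδ0 hδ1 hτ hpos hconv hξ,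
      volume_section_perturbed (k := j + 3) he hn hδ0 hδ1 hτ hpos0 hconv0 hξ]
    exact ENNReal.ofReal_le_ofReal
      (volume_section_perturbed_le (k := j + 3) he hn hδ0 hδ1 hτ hη hξ)
  rw [volume_perturbed (k := j + 3) he hn hδ0 hδ1 hτ hpos hconv,
    volume_perturbed (k := j + 3) he hn hδ0 hδ1 hτ hpos0 hconv0] at hle
  have hlt := volume_lt_volume_perturbed (k := j + 3) he hn hδ0 hδ1 hτ hη hpos hneg
  refine hle.not_gt ((ENNReal.ofReal_lt_ofReal_iff_of_nonneg ?_).2 hlt)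
  exact integral_nonneg fun θ => div_nonneg (Real.rpow_nonneg
    (hpos0 _ (ne_zero_of_mem_unit_sphere θ)).le _) (Nat.cast_nonneg _)

end Comparison

theorem theorem4 :
    (∃ K : Set (E 5), IsConvexBody K ∧ IsOriginSymmetric K ∧ ¬ IsIntersectionBody K) ∧
    (∀ ε : ℝ, 0 < ε → ε < 1 →
      IsConvexBody (revolutionBody ε) ∧ IsOriginSymmetric (revolutionBody ε)) ∧
    (∀ ε : ℝ, 3 / 4 < ε → ε < 1 →
      ¬ IsPositiveDefiniteDistribution (radialFunction (revolutionBody ε)) ∧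
      ¬ IsIntersectionBody (revolutionBody ε)) ∧
    (∀ n : ℕ, 5 ≤ n → ¬ BusemannPettyAffirmative n) := by
  refine ⟨⟨revolutionBody (7 / 8), isConvexBody_revolutionBody (by norm_num),
    isOriginSymmetric_revolutionBody _, not_isIntersectionBody_revolutionBody (by norm_num)
      (by norm_num)⟩, fun ε hε _ => ⟨isConvexBody_revolutionBody hε,
    isOriginSymmetric_revolutionBody ε⟩, fun ε hε hε1 =>
    ⟨not_isPositiveDefiniteDistribution_revolutionBody hε hε1,
      not_isIntersectionBody_revolutionBody hε hε1⟩, fun n hn => not_busemannPettyAffirmative hn⟩
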